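/- Let $d\ge 2$, $\lambda_S\in(0,\infty)$, and let $X_S$ be a homogeneous Poisson point process on $\mathbb R^d$ with intensity $\lambda_S$. Let $S$ be its Poisson–Voronoi tessellation, with edges (1-facets, called streets) $E$ and vertices (0-facets, called crossroads) $V$, and let $\Lambda(B)=\nu_1(S\cap B)$ be the total edge length in a Borel set $B$, where $\nu_1$ is the one-dimensional Hausdorff measure. Let $\gamma=\mathbb E[\Lambda([0,1]^d)]$ be the street intensity and $\bar l$ the mean length of the typical edge of $S$. Given $\lambda\ge 0$, $p\in[0,1]$ and $r\in(0,\infty]$, let $X$ be a Cox point process driven by $\lambda\Lambda$ (given the tessellation, a Poisson point process with mean measure $\lambda\Lambda$), let $Y$ be the point process obtained, given the tessellation, by retaining each crossroad independently with probability $p$, and let $X$ and $Y$ be conditionally independent given the tessellation. The connectivity graph $\mathcal G$ has as vertices the points of $Z=X\cup Y$, two distinct points being joined if and only if they lie on a common street and their Euclidean distance is at most $r$. Put $U=\lambda\bar l$ and $H=\bar l/r$ (so $U=0$ means $\lambda=0$, and $H=0$ means $r=\infty$), and let $P(p,U,H)$ be the probability that $\mathcal G$ percolates, i.e. has an infinite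 connected component. Then for all $\gamma>0$, $p\in[0,1]$, $U\ge 0$ and $H\ge 0$, percolation of $\mathcal G$ is an event (up to null sets), and $$P(p,U,H)\in\{0,1\}.$$ -/

import Mathlib

open MeasureTheory ProbabilityTheory
open scoped ENNReal NNReal

noncomputable section

namespace VoronoiPercolation

/-- Euclidean space `ℝ^d`. -/
abbrev Space (d : ℕ) : Type := EuclideanSpace ℝ (Fin d)

/-- Locally finite point configurations in `ℝ^d` (without multiplicities). -/
structure Configuration (d : ℕ) where
  carrier : Set (Space d)
  locallyFinite : ∀ B : Set (Space d), Bornology.IsBounded B → (carrier ∩ B).Finite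

variable {d : ℕ}

/-- The number of points of a configuration in `B`. -/
def Configuration.count (φ : Configuration d) (B : Set (Space d)) : ℕ∞ :=
  (φ.carrier ∩ B).encard

/-- The usual σ-algebra on configurations: the one generated by the counts in Borel sets. -/
instance : MeasurableSpace (Configuration d) :=
  ⨆ (B : Set (Space d)) (_ : MeasurableSet B),
    MeasurableSpace.comap (fun φ : Configuration d => φ.count B) inferInstance

/-! ### Laws of point processes -/

/-- `ρ` is the law of a Poisson point process with mean measure `μ`. -/
structure IsPoissonLaw (ρ : Measure (Configuration d)) (μ : Measure (Space d)) : Prop where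
  isProbabilityMeasure : IsProbabilityMeasure ρ
  count_eq : ∀ B : Set (Space d), MeasurableSet B → μ B ≠ ∞ → ∀ k : ℕ,
    ρ {s | s.count B = k} = poissonMeasure (μ B).toNNReal {k}
  indep : ∀ (n : ℕ) (B : Fin n → Set (Space d)), (∀ i, MeasurableSet (B i)) →
    Pairwise (fun i j => Disjoint (B i) (B j)) →
    iIndepFun (fun i (s : Configuration d) => s.count (B i)) ρ

/-- `ρ` is the law of the Bernoulli point process on `V` with parameter `p`: each point of `V` is
retained independently with probability `p`. -/
structure IsBernoulliLaw (ρ : Measure (Configuration d)) (V : Set (Space d)) (p : ℝ) : Prop where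
  isProbabilityMeasure : IsProbabilityMeasure ρ
  subset : ∀ᵐ s ∂ρ, s.carrier ⊆ V
  prob_mem : ∀ v ∈ V, ρ {s | v ∈ s.carrier} = ENNReal.ofReal p
  indep : iIndepSet (fun v : V => {s : Configuration d | (v : Space d) ∈ s.carrier}) ρ

/-! ### The Voronoi tessellation -/

/-- The Voronoi cell of `x` with respect to the configuration `φ`. -/
def cell (φ : Configuration d) (x : Space d) : Set (Space d) :=
  {y | ∀ z ∈ φ.carrier, dist y x ≤ dist y z}

/-- The `k`-facets of the Voronoi tessellation of `φ`: the nonempty `k`-dimensional intersections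
of Voronoi cells of points of `φ`. -/
def facets (φ : Configuration d) (k : ℕ) : Set (Set (Space d)) :=
  {F | F.Nonempty ∧ Module.finrank ℝ (vectorSpan ℝ F) = k ∧
    ∃ A : Set (Space d), A.Nonempty ∧ A ⊆ φ.carrier ∧ F = ⋂ x ∈ A, cell φ x}

/-- The edges of the Voronoi tessellation. -/
def streets (φ : Configuration d) : Set (Set (Space d)) := facets φ 1

/-- The vertices of the Voronoi tessellation. -/
def crossroads (φ : Configuration d) : Set (Space d) := {v | {v} ∈ facets φ 0}

/-- The street measure `Λ(B) = ν₁(S ∩ B)`, with `S` the union of all edges and `ν₁` the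
one-dimensional Hausdorff measure. -/
def streetMeasure (φ : Configuration d) : Measure (Space d) :=
  (Measure.hausdorffMeasure 1).restrict (⋃₀ streets φ)

/-! ### Intensity and mean length of streets -/

/-- The unit cube `[0,1]^d`. -/
def unitCube (d : ℕ) : Set (Space d) := {x | ∀ i, x i ∈ Set.Icc (0 : ℝ) 1}

/-- The barycenter of an edge with respect to length; for a segment this is its midpoint. -/
def streetCenter (e : Set (Space d)) : Space d :=
  average ((Measure.hausdorffMeasure 1).restrict e) (fun x => x)

/-- The edges whose center lies in the unit cube. -/
def streetsInCube (φ : Configuration d) : Set (Set (Space d)) :=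
  {e | e ∈ streets φ ∧ streetCenter e ∈ unitCube d}

variable {Ω : Type*} [MeasurableSpace Ω]

/-- The street intensity `γ = 𝔼[Λ([0,1]^d)]`. -/
def streetIntensity (P : Measure Ω) (XS : Ω → Configuration d) : ℝ≥0∞ :=
  ∫⁻ ω, streetMeasure (XS ω) (unitCube d) ∂P

/-- The mean length of the typical street, i.e. the Palm mean of the length: the expected total
length of the streets centered in the unit cube over the expected number of such streets. -/
def meanStreetLength (P : Measure Ω) (XS : Ω → Configuration d) : ℝ≥0∞ :=
  (∫⁻ ω, ∑' e : streetsInCube (XS ω), Measure.hausdorffMeasure 1 (e : Set (Space d)) ∂P) /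
    (∫⁻ ω, ((streetsInCube (XS ω)).encard : ℝ≥0∞) ∂P)

/-! ### The network model -/

/-- The joint law of the generating process `XS`, the users `X` and the relays `Y`: `XS` is a
homogeneous Poisson point process with intensity `lamS`; conditionally on `XS`, the processes
`X` and `Y` are independent, `X` is a Poisson point process with mean measure `lam • Λ`
(so `X` is a Cox process), and `Y` is a Bernoulli process on the crossroads with parameter `p`. -/
structure IsNetwork (P : Measure Ω) (lamS lam : ℝ≥0) (p : ℝ)
    (XS X Y : Ω → Configuration d) : Prop where
  measurable_XS : Measurable XS
  measurable_X : Measurable X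
  measurable_Y : Measurable Y
  poisson : IsPoissonLaw (P.map XS) (lamS • (volume : Measure (Space d)))
  conditional : ∃ κ η : Kernel (Configuration d) (Configuration d),
    IsMarkovKernel κ ∧ IsMarkovKernel η ∧
    (∀ᵐ φ ∂(P.map XS), IsPoissonLaw (κ φ) (lam • streetMeasure φ)) ∧
    (∀ᵐ φ ∂(P.map XS), IsBernoulliLaw (η φ) (crossroads φ) p) ∧
    P.map (fun ω => (XS ω, X ω, Y ω)) = (P.map XS).compProd (κ.prod η)

/-- The connectivity graph on the superposition `Z` of the users `X` and the relays `Y`: two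
distinct points are linked iff they lie on a common street of the Voronoi tessellation of `φ` and
their distance is at most `r` (where `r = ∞` is allowed). -/
def connectivityGraph (r : ℝ≥0∞) (φ X Y : Configuration d) :
    SimpleGraph ↥(X.carrier ∪ Y.carrier) where
  Adj z w := z ≠ w ∧
    (∃ e ∈ streets φ, (z : Space d) ∈ e ∧ (w : Space d) ∈ e) ∧ edist (z : Space d) w ≤ r
  symm := ⟨fun _ _ h =>
    ⟨h.1.symm, h.2.1.imp fun _ he => ⟨he.1, he.2.2, he.2.1⟩, edist_comm (α := Space d) _ _ ▸ h.2.2⟩⟩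
  loopless := ⟨fun _ h => h.1 rfl⟩

/-- The connectivity graph percolates, i.e. has an infinite connected component. -/
def Percolates (r : ℝ≥0∞) (φ X Y : Configuration d) : Prop :=
  ∃ C : (connectivityGraph r φ X Y).ConnectedComponent, C.supp.Infinite

end VoronoiPercolation

end

/-! A translation-invariant event `A` of a mixing system satisfies μ(A) = μ(A)². So it suffices that
the joint law of (`XS`, `X`, `Y`) is stationary and mixing along one direction, and that percolation
is a measurable, translation-invariant set of triples.

The joint law is handled through void probabilities. Void events of bounded Borel sets form a
π-system generating the σ-algebra (`generateFrom_voidEvents`). Given `XS` = φ, the three processes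
avoid C₀, C₁, C₂ with probability `voidProb`, that is 1{φ ∩ C₀ = ∅} · exp(-λΛ(C₁)) · (1 - p)^#(V ∩
C₂). This function is translation covariant (`voidProb_shift`) and factorizes over disjoint windows
(`voidProb_union`). Stationarity is thus inherited from the Poisson process `XS`. For mixing, the
windows are moved apart and the joint void probability becomes E[f · g∘shift] for two functions f, g
of `XS`. These are not independent, since a tessellation in a window depends on distant nuclei, but
mixing of `XS`, extended from sets to functions (`tendsto_lintegral_mul_comp`), splits the limit.

For measurability, countably many measurable maps enumerate the points of a configuration, lying on
a common street is a condition on finitely many nuclei (`exists_street_iff`), and a component is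
infinite iff it is unbounded (`percolates_iff`). -/

noncomputable section

namespace VoronoiPercolation

variable {d : ℕ}

/-! ### Mixing: from a π-system to sets, functions and invariant events. -/

section Mixing

open Filter Topology

variable {α : Type*} [mα : MeasurableSpace α]

/-- If `T n` preserves `μ` and is mixing on a generating `π`-system, it is mixing on all measurable
sets. -/
theorem tendsto_measure_inter_preimage_of_generateFrom {μ : Measure α} [IsProbabilityMeasure μ]
    {T : ℕ → α → α} (hT : ∀ n, MeasurePreserving (T n) μ μ) {𝒮 : Set (Set α)}
    (hgen : mα = MeasurableSpace.generateFrom 𝒮) (hpi : IsPiSystem 𝒮)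
    (hmix : ∀ D ∈ 𝒮, ∀ E ∈ 𝒮, Tendsto (fun n => μ (D ∩ T n ⁻¹' E)) atTop (𝓝 (μ D * μ E)))
    {D E : Set α} (hD : MeasurableSet D) (hE : MeasurableSet E) :
    Tendsto (fun n => μ (D ∩ T n ⁻¹' E)) atTop (𝓝 (μ D * μ E)) := by
  have h𝒮 : ∀ D ∈ 𝒮, MeasurableSet D := fun D hD => by
    rw [hgen]; exact MeasurableSpace.measurableSet_generateFrom hD
  have hpre : ∀ n {E : Set α}, MeasurableSet E → MeasurableSet (T n ⁻¹' E) :=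
    fun n E hE => (hT n).measurable hE
  -- Two Dynkin-type inductions: `E` is made arbitrary with `D` in the π-system, then `D` is made
  -- arbitrary.
  have step : ∀ D ∈ 𝒮, ∀ E, MeasurableSet E →
      Tendsto (fun n => μ (D ∩ T n ⁻¹' E)) atTop (𝓝 (μ D * μ E)) := by
    intro D hD E hE
    induction E, hE using MeasurableSpace.induction_on_inter hgen hpi with
    | empty => simp
    | basic E hE => exact hmix D hD E hE
    | compl E hE ih =>
      have h1 : ∀ n, μ (D ∩ T n ⁻¹' Eᶜ) = μ D - μ (D ∩ T n ⁻¹' E) := fun n => by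
        rw [Set.preimage_compl, ← Set.sdiff_eq, ← Set.sdiff_inter_self_eq_sdiff, Set.inter_comm,
          measure_sdiff Set.inter_subset_left ((h𝒮 D hD).inter (hpre n hE)).nullMeasurableSet
            (measure_ne_top _ _)]
      have h2 : μ D * μ Eᶜ = μ D - μ D * μ E := by
        rw [prob_compl_eq_one_sub hE, ENNReal.mul_sub (fun _ _ => measure_ne_top _ _), mul_one]
      simp_rw [h1, h2]
      exact ENNReal.Tendsto.sub tendsto_const_nhds ih (Or.inl (measure_ne_top _ _))
    | iUnion E hdisj hE ih =>
      have h1 : ∀ n, μ (D ∩ T n ⁻¹' ⋃ i, E i) = ∑' i, μ (D ∩ T n ⁻¹' E i) := fun n => by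
        rw [Set.preimage_iUnion, Set.inter_iUnion, measure_iUnion]
        · intro i j hij
          exact ((hdisj hij).preimage _).mono Set.inter_subset_right Set.inter_subset_right
        · exact fun i => (h𝒮 D hD).inter (hpre n (hE i))
      have h2 : μ D * μ (⋃ i, E i) = ∑' i, μ D * μ (E i) := by
        rw [measure_iUnion hdisj hE, ENNReal.tsum_mul_left]
      simp_rw [h1, h2, ← lintegral_count]
      -- The series is an integral against counting measure; by invariance the terms are bounded by
      -- `μ (E i)`, which is summable by disjointness.
      refine tendsto_lintegral_of_dominated_convergence (fun i => μ (E i)) (fun n => ?_)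
        (fun n => ?_) ?_ ?_
      · exact measurable_of_countable _
      · refine Eventually.of_forall fun i => ?_
        exact (measure_mono Set.inter_subset_right).trans
          ((hT n).measure_preimage (hE i).nullMeasurableSet).le
      · rw [lintegral_count, ← measure_iUnion hdisj hE]
        exact measure_ne_top _ _
      · exact Eventually.of_forall ih
  induction D, hD using MeasurableSpace.induction_on_inter hgen hpi with
  | empty => simp
  | basic D hD => exact step D hD E hE
  | compl D hD ih =>
    have h1 : ∀ n, μ (Dᶜ ∩ T n ⁻¹' E) = μ E - μ (D ∩ T n ⁻¹' E) := fun n => by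
      rw [Set.inter_comm, ← Set.sdiff_eq, ← Set.sdiff_inter_self_eq_sdiff,
        measure_sdiff Set.inter_subset_right (hD.inter (hpre n hE)).nullMeasurableSet
          (measure_ne_top _ _), (hT n).measure_preimage hE.nullMeasurableSet]
    have h2 : μ Dᶜ * μ E = μ E - μ D * μ E := by
      rw [prob_compl_eq_one_sub hD, ENNReal.sub_mul (fun _ _ => measure_ne_top _ _), one_mul]
    simp_rw [h1, h2]
    exact ENNReal.Tendsto.sub tendsto_const_nhds ih (Or.inl (measure_ne_top _ _))
  | iUnion D hdisj hD ih =>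
    have h1 : ∀ n, μ ((⋃ i, D i) ∩ T n ⁻¹' E) = ∑' i, μ (D i ∩ T n ⁻¹' E) := fun n => by
      rw [Set.iUnion_inter, measure_iUnion]
      · intro i j hij
        exact (hdisj hij).mono Set.inter_subset_left Set.inter_subset_left
      · exact fun i => (hD i).inter (hpre n hE)
    have h2 : μ (⋃ i, D i) * μ E = ∑' i, μ (D i) * μ E := by
      rw [measure_iUnion hdisj hD, ENNReal.tsum_mul_right]
    simp_rw [h1, h2, ← lintegral_count]
    refine tendsto_lintegral_of_dominated_convergence (fun i => μ (D i)) (fun n => ?_)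
      (fun n => ?_) ?_ ?_
    · exact measurable_of_countable _
    · exact Eventually.of_forall fun i => measure_mono Set.inter_subset_left
    · rw [lintegral_count, ← measure_iUnion hdisj hD]
      exact measure_ne_top _ _
    · exact Eventually.of_forall ih

/-- Setwise convergence of finite measures implies convergence of the integrals of
`[0,1]`-valued functions. -/
theorem tendsto_lintegral_of_tendsto_measure {ν : ℕ → Measure α} {ν' : Measure α}
    (hν1 : ∀ n, ν n Set.univ ≤ 1)
    (hν : ∀ D, MeasurableSet D → Tendsto (fun n => ν n D) atTop (𝓝 (ν' D)))
    {f : α → ℝ} (hf : Measurable f) (hf0 : ∀ x, 0 ≤ f x) (hf1 : ∀ x, f x ≤ 1) :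
    Tendsto (fun n => ∫⁻ x, ENNReal.ofReal (f x) ∂(ν n)) atTop
      (𝓝 (∫⁻ x, ENNReal.ofReal (f x) ∂ν')) := by
  -- Layer cake: setwise convergence is pointwise convergence of the tails in `t`, and the tails
  -- vanish for `t ≥ 1`, which gives the dominating function.
  simp_rw [lintegral_eq_lintegral_meas_lt _ (Eventually.of_forall hf0) hf.aemeasurable]
  refine tendsto_lintegral_of_dominated_convergence ((Set.Iio (1 : ℝ)).indicator 1) (fun n => ?_)
    (fun n => ?_) ?_ ?_
  · refine Antitone.measurable fun s t hst => measure_mono fun x hx => ?_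
    exact lt_of_le_of_lt hst hx
  · refine Eventually.of_forall fun t => ?_
    by_cases ht : t < 1
    · rw [Set.indicator_of_mem (Set.mem_Iio.2 ht)]
      exact (measure_mono (Set.subset_univ _)).trans (hν1 n)
    · have : {a | t < f a} = ∅ := by
        ext a; simpa using (hf1 a).trans (not_lt.1 ht)
      simp [this]
  · rw [lintegral_indicator_one measurableSet_Iio, Measure.restrict_apply measurableSet_Iio,
      Set.inter_comm, Set.Ioi_inter_Iio]
    simp
  · exact Eventually.of_forall fun t => hν _ (measurableSet_lt measurable_const hf)

/-- Mixing for sets implies mixing for `[0,1]`-valued functions. -/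
theorem tendsto_lintegral_mul_comp {μ : Measure α} [IsProbabilityMeasure μ]
    {T : ℕ → α → α} (hT : ∀ n, Measurable (T n))
    (hmix : ∀ D E, MeasurableSet D → MeasurableSet E →
      Tendsto (fun n => μ (D ∩ T n ⁻¹' E)) atTop (𝓝 (μ D * μ E)))
    {f g : α → ℝ} (hf : Measurable f) (hf0 : ∀ x, 0 ≤ f x) (hf1 : ∀ x, f x ≤ 1)
    (hg : Measurable g) (hg0 : ∀ x, 0 ≤ g x) (hg1 : ∀ x, g x ≤ 1) :
    Tendsto (fun n => ∫⁻ x, ENNReal.ofReal (f x) * ENNReal.ofReal (g (T n x)) ∂μ) atTop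
      (𝓝 ((∫⁻ x, ENNReal.ofReal (f x) ∂μ) * ∫⁻ x, ENNReal.ofReal (g x) ∂μ)) := by
  have hfm : Measurable fun x => ENNReal.ofReal (f x) := hf.ennreal_ofReal
  have hgm : Measurable fun x => ENNReal.ofReal (g x) := hg.ennreal_ofReal
  have hone : ∫⁻ x, ENNReal.ofReal (f x) ∂μ ≤ 1 :=
    (lintegral_mono fun x => ENNReal.ofReal_le_one.2 (hf1 x)).trans (by simp)
  -- The previous lemma is used twice: here to pass from sets to `g`, with the images under `T n` of
  -- the measure of density `f`; below to pass from sets to `f`, with `μ` restricted to the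
  -- preimages of `E`.
  have key := tendsto_lintegral_of_tendsto_measure
    (ν := fun n => (μ.withDensity fun x => ENNReal.ofReal (f x)).map (T n))
    (ν' := (∫⁻ x, ENNReal.ofReal (f x) ∂μ) • μ) ?_ ?_ hg hg0 hg1
  · rw [lintegral_smul_measure, smul_eq_mul] at key
    refine key.congr fun n => ?_
    rw [lintegral_map hgm (hT n)]
    exact lintegral_withDensity_eq_lintegral_mul _ hfm (hgm.comp (hT n))
  · intro n
    rw [Measure.map_apply (hT n) MeasurableSet.univ, Set.preimage_univ,
      withDensity_apply _ MeasurableSet.univ, Measure.restrict_univ]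
    exact hone
  · intro E hE
    have h := tendsto_lintegral_of_tendsto_measure (ν := fun n => μ.restrict (T n ⁻¹' E))
      (ν' := μ E • μ) ?_ ?_ hf hf0 hf1
    · rw [lintegral_smul_measure, smul_eq_mul, mul_comm] at h
      rw [Measure.smul_apply, smul_eq_mul]
      refine h.congr fun n => ?_
      rw [Measure.map_apply (hT n) hE, withDensity_apply _ (hT n hE)]
    · intro n
      rw [Measure.restrict_apply_univ]
      exact prob_le_one
    · intro D hD
      rw [Measure.smul_apply, smul_eq_mul, mul_comm]
      refine (hmix D E hD hE).congr fun n => ?_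
      rw [Measure.restrict_apply hD]

/-- Invariant events of a mixing sequence are trivial. -/
theorem measure_eq_zero_or_one_of_mixing {μ : Measure α} [IsProbabilityMeasure μ]
    {T : ℕ → α → α}
    (hmix : ∀ D E, MeasurableSet D → MeasurableSet E →
      Tendsto (fun n => μ (D ∩ T n ⁻¹' E)) atTop (𝓝 (μ D * μ E)))
    {A : Set α} (hA : MeasurableSet A) (hinv : ∀ n, T n ⁻¹' A = A) : μ A = 0 ∨ μ A = 1 := by
  have h := hmix A A hA hA
  simp_rw [hinv, Set.inter_self] at h
  have h2 : μ A = μ A * μ A := tendsto_nhds_unique tendsto_const_nhds h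
  by_cases h0 : μ A = 0
  · exact Or.inl h0
  · right
    have := (ENNReal.mul_right_inj h0 (measure_ne_top μ A)).1 ((mul_one (μ A)).trans h2)
    exact this.symm

end Mixing

/-! ### The configuration space: void events, enumeration of points, translations. -/

section Configurations

theorem measurable_count {B : Set (Space d)} (hB : MeasurableSet B) :
    Measurable fun φ : Configuration d => φ.count B := by
  rw [measurable_iff_comap_le]
  exact le_iSup₂_of_le B hB le_rfl

theorem Configuration.ext_carrier {φ ψ : Configuration d} (h : φ.carrier = ψ.carrier) : φ = ψ := by
  cases φ; cases ψ; cases h; rfl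

/-- The event that a configuration has no point in `C`. -/
def voidEvent (C : Set (Space d)) : Set (Configuration d) := {φ | Disjoint φ.carrier C}

theorem voidEvent_eq_count (C : Set (Space d)) :
    voidEvent C = {φ : Configuration d | φ.count C = (0 : ℕ)} := by
  ext φ
  simp [voidEvent, Configuration.count, Set.disjoint_iff_inter_eq_empty]

theorem measurableSet_voidEvent {C : Set (Space d)} (hC : MeasurableSet C) :
    MeasurableSet (voidEvent C) := by
  rw [voidEvent_eq_count]
  exact measurable_count hC (measurableSet_singleton _)

theorem voidEvent_inter (C D : Set (Space d)) :
    voidEvent C ∩ voidEvent D = voidEvent (C ∪ D) := by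
  ext φ
  simp [voidEvent]

theorem voidEvent_iUnion {ι : Sort*} (C : ι → Set (Space d)) :
    voidEvent (⋃ i, C i) = ⋂ i, voidEvent (C i) := by
  ext φ
  simp [voidEvent]

theorem voidEvent_empty : voidEvent (∅ : Set (Space d)) = Set.univ := by
  ext φ
  simp [voidEvent]

variable (d) in
/-- The void events of bounded Borel sets. -/
def voidEvents : Set (Set (Configuration d)) :=
  {E | ∃ C : Set (Space d), MeasurableSet C ∧ Bornology.IsBounded C ∧ E = voidEvent C}

theorem isPiSystem_voidEvents : IsPiSystem (voidEvents d) := by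
  rintro _ ⟨C, hC, hCb, rfl⟩ _ ⟨D, hD, hDb, rfl⟩ _
  exact ⟨C ∪ D, hC.union hD, hCb.union hDb, voidEvent_inter C D⟩

theorem univ_mem_voidEvents : Set.univ ∈ voidEvents d :=
  ⟨∅, MeasurableSet.empty, Bornology.isBounded_empty, voidEvent_empty.symm⟩

theorem isCountablySpanning_voidEvents : IsCountablySpanning (voidEvents d) :=
  ⟨fun _ => Set.univ, fun _ => univ_mem_voidEvents, Set.iUnion_const _⟩

/-- A set has at least `k` points iff it meets `k` disjoint basic open sets. -/
theorem natCast_le_encard_iff (s : Set (Space d)) (k : ℕ) :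
    (k : ℕ∞) ≤ s.encard ↔ ∃ U : Fin k → TopologicalSpace.countableBasis (Space d),
      (Pairwise fun i j => Disjoint (U i : Set (Space d)) (U j)) ∧
        ∀ i, (s ∩ (U i : Set (Space d))).Nonempty := by
  constructor
  · intro h
    obtain ⟨t, hts, htk⟩ := Set.exists_subset_encard_eq h
    have hfin : t.Finite := Set.finite_of_encard_eq_coe htk
    obtain ⟨V, hV, hdisj⟩ := hfin.t2_separation
    have hbas := TopologicalSpace.isBasis_countableBasis (Space d)
    have hU : ∀ x : Space d, ∃ U ∈ TopologicalSpace.countableBasis (Space d), x ∈ U ∧ U ⊆ V x :=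
      fun x => hbas.exists_subset_of_mem_open (hV x).1 (hV x).2
    choose U hUb hxU hUV using hU
    have hcard : t.ncard = k := by rw [Set.ncard, htk]; rfl
    have e : Fin k ≃ t := by
      haveI := hfin.fintype
      refine (Fintype.equivFinOfCardEq ?_).symm
      rw [← hcard, Set.ncard_eq_toFinset_card', Set.toFinset_card]
    refine ⟨fun i => ⟨U (e i), hUb _⟩, fun i j hij => ?_, fun i => ⟨e i, hts (e i).2, hxU _⟩⟩
    refine (hdisj (e i).2 (e j).2 fun h => hij (e.injective (Subtype.ext h))).mono ?_ ?_
    · exact hUV _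
    · exact hUV _
  · rintro ⟨U, hU, hne⟩
    choose x hx using hne
    have hinj : Function.Injective x := fun i j hij => by
      by_contra hne
      exact Set.disjoint_left.1 (hU hne) (hx i).2 (hij ▸ (hx j).2)
    calc (k : ℕ∞) = (Set.range x).encard := by
          rw [← Set.image_univ, hinj.encard_image, Set.encard_univ]; simp
      _ ≤ s.encard := Set.encard_le_encard (Set.range_subset_iff.2 fun i => (hx i).1)

theorem measurableSet_generateFrom_voidEvent {C : Set (Space d)} (hC : MeasurableSet C) :
    MeasurableSet[MeasurableSpace.generateFrom (voidEvents d)] (voidEvent C) := by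
  have h : voidEvent C = ⋂ n : ℕ, voidEvent (C ∩ Metric.ball 0 n) := by
    rw [← voidEvent_iUnion, ← Set.inter_iUnion, Metric.iUnion_ball_nat, Set.inter_univ]
  rw [h]
  refine MeasurableSet.iInter fun n => MeasurableSpace.measurableSet_generateFrom ?_
  exact ⟨_, hC.inter Metric.isOpen_ball.measurableSet,
    Metric.isBounded_ball.subset Set.inter_subset_right, rfl⟩

/-- Configurations carry no multiplicities, so a count is at least `k` iff `k` disjoint basic open
sets each meet the points in `B`. There are countably many choices of basic sets, and each such
condition is the complement of a void event. -/
theorem generateFrom_voidEvents :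
    instMeasurableSpaceConfiguration (d := d) = MeasurableSpace.generateFrom (voidEvents d) := by
  apply le_antisymm
  · refine iSup₂_le fun B hB => ?_
    rw [← measurable_iff_comap_le]
    have hle : ∀ k : ℕ, MeasurableSet[MeasurableSpace.generateFrom (voidEvents d)]
        {φ : Configuration d | (k : ℕ∞) ≤ φ.count B} := by
      intro k
      have h : {φ : Configuration d | (k : ℕ∞) ≤ φ.count B} =
          ⋃ U : {U : Fin k → TopologicalSpace.countableBasis (Space d) //
            Pairwise fun i j => Disjoint (U i : Set (Space d)) (U j)},
            ⋂ i, (voidEvent (B ∩ (U.1 i : Set (Space d))))ᶜ := by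
        ext φ
        simp only [Configuration.count, natCast_le_encard_iff, Set.mem_ofPred_eq, Set.mem_iUnion,
          Set.mem_iInter, Set.mem_compl_iff, voidEvent, Set.disjoint_iff_inter_eq_empty,
          ← Set.nonempty_iff_ne_empty, ← ne_eq, Subtype.exists, exists_prop, Set.inter_assoc]
      rw [h]
      refine MeasurableSet.iUnion fun U => MeasurableSet.iInter fun i => MeasurableSet.compl ?_
      exact measurableSet_generateFrom_voidEvent (hB.inter
        (TopologicalSpace.isOpen_of_mem_countableBasis (U.1 i).2).measurableSet)
    have hfin : ∀ k : ℕ, MeasurableSet[MeasurableSpace.generateFrom (voidEvents d)]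
        ((fun φ : Configuration d => φ.count B) ⁻¹' {(k : ℕ∞)}) := by
      intro k
      have h : ((fun φ : Configuration d => φ.count B) ⁻¹' {(k : ℕ∞)}) =
          {φ | (k : ℕ∞) ≤ φ.count B} \ {φ | ((k + 1 : ℕ) : ℕ∞) ≤ φ.count B} := by
        ext φ
        simp only [Set.mem_preimage, Set.mem_singleton_iff, Set.mem_sdiff, Set.mem_ofPred_eq, not_le,
          Nat.cast_add, Nat.cast_one, ENat.lt_natCast_add_one_iff]
        exact ⟨fun h => ⟨h.ge, h.le⟩, fun h => le_antisymm h.2 h.1⟩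
      rw [h]
      exact (hle k).diff (hle (k + 1))
    refine @measurable_to_countable' _ _ _ _ (MeasurableSpace.generateFrom (voidEvents d)) _ ?_
    intro k
    induction k using ENat.recTopCoe with
    | coe k => exact hfin k
    | top =>
      have h : ((fun φ : Configuration d => φ.count B) ⁻¹' {(⊤ : ℕ∞)}) =
          ⋂ k : ℕ, ((fun φ : Configuration d => φ.count B) ⁻¹' {(k : ℕ∞)})ᶜ := by
        ext φ
        simp only [Set.mem_preimage, Set.mem_singleton_iff, Set.mem_iInter, Set.mem_compl_iff]
        constructor
        · intro h k; rw [h]; exact ENat.top_ne_natCast k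
        · intro h
          by_contra hne
          obtain ⟨k, hk⟩ := ENat.ne_top_iff_exists.1 hne
          exact h k hk.symm
      rw [h]
      exact MeasurableSet.iInter fun k => (hfin k).compl
  · refine MeasurableSpace.generateFrom_le ?_
    rintro _ ⟨C, hC, -, rfl⟩
    exact measurableSet_voidEvent hC

/-! ### Measurable enumeration of the points -/

/-- The configuration has exactly one point in `U`. -/
def UniqueIn (U : Set (Space d)) (φ : Configuration d) : Prop := φ.count U = 1

open Classical in
/-- The unique point of the configuration in `U`, and `0` if there is no such point. -/
def pointIn (U : Set (Space d)) (φ : Configuration d) : Space d :=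
  if h : UniqueIn U φ then (Set.encard_eq_one.1 h).choose else 0

theorem inter_eq_pointIn {U : Set (Space d)} {φ : Configuration d} (h : UniqueIn U φ) :
    φ.carrier ∩ U = {pointIn U φ} := by
  rw [pointIn, dif_pos h]
  exact (Set.encard_eq_one.1 h).choose_spec

theorem pointIn_mem {U : Set (Space d)} {φ : Configuration d} (h : UniqueIn U φ) :
    pointIn U φ ∈ φ.carrier :=
  ((inter_eq_pointIn h).ge rfl).1

theorem measurableSet_uniqueIn {U : Set (Space d)} (hU : MeasurableSet U) :
    MeasurableSet {φ : Configuration d | UniqueIn U φ} :=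
  measurable_count hU (measurableSet_singleton (1 : ℕ∞))

/-- When the point in `U` is unique, it lies in `C` iff the configuration meets `U ∩ C`; otherwise
the value is the constant 0. -/
theorem measurable_pointIn {U : Set (Space d)} (hU : MeasurableSet U) :
    Measurable (pointIn U : Configuration d → Space d) := by
  intro C hC
  have h : pointIn U ⁻¹' C =
      ({φ : Configuration d | UniqueIn U φ} ∩ (voidEvent (U ∩ C))ᶜ) ∪
        ({φ : Configuration d | UniqueIn U φ}ᶜ ∩ {_φ | (0 : Space d) ∈ C}) := by
    ext φ
    by_cases hφ : UniqueIn U φ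
    · have : φ.carrier ∩ (U ∩ C) = {pointIn U φ} ∩ C := by
        rw [← Set.inter_assoc, inter_eq_pointIn hφ]
      simp [hφ, voidEvent, Set.disjoint_iff_inter_eq_empty, this]
    · simp [hφ, pointIn]
  rw [h]
  exact ((measurableSet_uniqueIn hU).inter (measurableSet_voidEvent (hU.inter hC)).compl).union
    ((measurableSet_uniqueIn hU).compl.inter (MeasurableSet.const _))

/-- Local finiteness isolates each point inside a basic open set. Hence the countably many maps
`pointIn U` reach every point, and quantifiers over points become countable unions. -/
theorem exists_pointIn_eq {φ : Configuration d} {x : Space d} (hx : x ∈ φ.carrier) :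
    ∃ U : TopologicalSpace.countableBasis (Space d), UniqueIn (U : Set (Space d)) φ ∧
      pointIn (U : Set (Space d)) φ = x := by
  have hfin := φ.locallyFinite (Metric.ball x 1) Metric.isBounded_ball
  have hopen : IsOpen (Metric.ball x 1 \ ((φ.carrier ∩ Metric.ball x 1) \ {x})) :=
    Metric.isOpen_ball.sdiff (hfin.subset Set.sdiff_subset).isClosed
  have hmem : x ∈ Metric.ball x 1 \ ((φ.carrier ∩ Metric.ball x 1) \ {x}) := by simp
  obtain ⟨U, hUb, hxU, hU⟩ :=
    (TopologicalSpace.isBasis_countableBasis (Space d)).exists_subset_of_mem_open hmem hopen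
  have h : φ.carrier ∩ U = {x} := by
    ext y
    simp only [Set.mem_inter_iff, Set.mem_singleton_iff]
    constructor
    · rintro ⟨hy, hyU⟩
      by_contra hne
      exact (hU hyU).2 ⟨⟨hy, (hU hyU).1⟩, hne⟩
    · rintro rfl
      exact ⟨hx, hxU⟩
  have h1 : UniqueIn U φ := by rw [UniqueIn, Configuration.count, h, Set.encard_singleton]
  refine ⟨⟨U, hUb⟩, h1, ?_⟩
  have := (inter_eq_pointIn h1).symm.trans h
  exact Set.singleton_injective this

variable {β : Type*} [MeasurableSpace β]

/-- Existential quantification over tuples of points of a configuration preserves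
measurability. -/
theorem measurableSet_exists_points {X : β → Configuration d} (hX : Measurable X) {n : ℕ}
    {p : β → (Fin n → Space d) → Prop}
    (hp : MeasurableSet {q : β × (Fin n → Space d) | p q.1 q.2}) :
    MeasurableSet {b | ∃ a : Fin n → Space d, (∀ k, a k ∈ (X b).carrier) ∧ p b a} := by
  have h : {b | ∃ a : Fin n → Space d, (∀ k, a k ∈ (X b).carrier) ∧ p b a} =
      ⋃ U : Fin n → TopologicalSpace.countableBasis (Space d),
        (⋂ k, X ⁻¹' {φ | UniqueIn (U k : Set (Space d)) φ}) ∩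
          (fun b => (b, fun k => pointIn (U k : Set (Space d)) (X b))) ⁻¹'
            {q : β × (Fin n → Space d) | p q.1 q.2} := by
    ext b
    simp only [Set.mem_ofPred_eq, Set.mem_iUnion, Set.mem_inter_iff, Set.mem_iInter,
      Set.mem_preimage]
    constructor
    · rintro ⟨a, ha, hpa⟩
      choose U hU hUa using fun k => exists_pointIn_eq (ha k)
      refine ⟨U, hU, ?_⟩
      rwa [funext hUa]
    · rintro ⟨U, hU, hpU⟩
      exact ⟨_, fun k => pointIn_mem (hU k), hpU⟩
  rw [h]
  have hU : ∀ U : TopologicalSpace.countableBasis (Space d), MeasurableSet (U : Set (Space d)) :=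
    fun U => (TopologicalSpace.isOpen_of_mem_countableBasis U.2).measurableSet
  refine MeasurableSet.iUnion fun U => (MeasurableSet.iInter fun k =>
    hX (measurableSet_uniqueIn (hU _))).inter ?_
  refine (measurable_id.prodMk (measurable_pi_lambda _ fun k => ?_)) hp
  exact (measurable_pointIn (hU _)).comp hX

theorem measurableSet_exists_point {X : β → Configuration d} (hX : Measurable X)
    {p : β → Space d → Prop} (hp : MeasurableSet {q : β × Space d | p q.1 q.2}) :
    MeasurableSet {b | ∃ x ∈ (X b).carrier, p b x} := by
  have hm : Measurable fun q : β × (Fin 1 → Space d) => (q.1, q.2 0) := by fun_prop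
  have h := measurableSet_exists_points hX (n := 1) (p := fun b a => p b (a 0)) (hm hp)
  convert h using 3 with b
  constructor
  · rintro ⟨x, hx, hpx⟩
    exact ⟨fun _ => x, fun _ => hx, hpx⟩
  · rintro ⟨a, ha, hpa⟩
    exact ⟨a 0, ha 0, hpa⟩

/-! ### Translations -/

/-- The configuration translated by `v`. -/
def shift (v : Space d) (φ : Configuration d) : Configuration d where
  carrier := {x | x - v ∈ φ.carrier}
  locallyFinite B hB := by
    have hb : Bornology.IsBounded ((fun x => x + v) ⁻¹' B) :=
      (IsometryEquiv.addRight v).isometry.antilipschitz.isBounded_preimage hB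
    refine ((φ.locallyFinite _ hb).image fun x => x + v).subset ?_
    rintro x ⟨hx, hxB⟩
    exact ⟨x - v, ⟨hx, by simpa using hxB⟩, by simp⟩

theorem mem_shift {v x : Space d} {φ : Configuration d} :
    x ∈ (shift v φ).carrier ↔ x - v ∈ φ.carrier := Iff.rfl

theorem shift_neg_shift (v : Space d) (φ : Configuration d) : shift (-v) (shift v φ) = φ :=
  Configuration.ext_carrier <| by ext x; simp [mem_shift]

theorem preimage_shift_voidEvent (v : Space d) (C : Set (Space d)) :
    shift v ⁻¹' voidEvent C = voidEvent ((fun x => x + v) ⁻¹' C) := by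
  ext φ
  simp only [voidEvent, Set.disjoint_left, Set.mem_preimage, Set.mem_ofPred_eq, mem_shift]
  constructor
  · intro h x hx
    exact h (a := x + v) (by simpa using hx)
  · intro h x hx hxC
    exact h hx (by simpa using hxC)

theorem isBounded_preimage_add {C : Set (Space d)} (hC : Bornology.IsBounded C) (v : Space d) :
    Bornology.IsBounded ((fun x => x + v) ⁻¹' C) :=
  (IsometryEquiv.addRight v).isometry.antilipschitz.isBounded_preimage hC

theorem measurableSet_preimage_add {C : Set (Space d)} (hC : MeasurableSet C) (v : Space d) :
    MeasurableSet ((fun x => x + v) ⁻¹' C) :=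
  (measurable_add_const v) hC

theorem measurable_shift (v : Space d) : Measurable (shift v : Configuration d → _) := by
  refine Measurable.of_le_map ?_
  conv_lhs => rw [generateFrom_voidEvents]
  refine MeasurableSpace.generateFrom_le ?_
  rintro _ ⟨C, hC, -, rfl⟩
  change MeasurableSet (shift v ⁻¹' voidEvent C)
  rw [preimage_shift_voidEvent]
  exact measurableSet_voidEvent (measurableSet_preimage_add hC v)

end Configurations

/-! ### The Voronoi tessellation: local finiteness and translation covariance. -/

section Tessellation

open scoped Pointwise

/-! ### Local finiteness of the tessellation -/

/-- A facet is determined by its nuclei. If it meets a ball of radius `R` about a nucleus `x₀`, its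
nuclei are no farther from the meeting point than `x₀` is, hence within `2 * R` of `x₀`: finitely
many choices. -/
theorem finite_facets_inter (φ : Configuration d) (k : ℕ) {B : Set (Space d)}
    (hB : Bornology.IsBounded B) : {F | F ∈ facets φ k ∧ (F ∩ B).Nonempty}.Finite := by
  rcases φ.carrier.eq_empty_or_nonempty with h0 | ⟨x₀, hx₀⟩
  · convert Set.finite_empty
    ext F
    simp only [facets, Set.mem_ofPred_eq, Set.mem_empty_iff_false, iff_false]
    rintro ⟨⟨-, -, A, ⟨a, ha⟩, hA, -⟩, -⟩
    simpa [h0] using hA ha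
  obtain ⟨R, hR⟩ := hB.subset_closedBall x₀
  have hfin := φ.locallyFinite (Metric.closedBall x₀ (2 * R)) Metric.isBounded_closedBall
  refine (hfin.finite_subsets.image fun A => ⋂ x ∈ A, cell φ x).subset ?_
  rintro F ⟨⟨-, -, A, -, hAφ, rfl⟩, y, hyF, hyB⟩
  refine ⟨A, fun x hx => ⟨hAφ hx, ?_⟩, rfl⟩
  have h1 : dist y x ≤ dist y x₀ := (Set.mem_iInter₂.1 hyF x hx) x₀ hx₀
  have h2 : dist y x₀ ≤ R := hR hyB
  have h3 := dist_triangle_left x x₀ y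
  rw [Metric.mem_closedBall]
  linarith

theorem finite_crossroads_inter (φ : Configuration d) {B : Set (Space d)}
    (hB : Bornology.IsBounded B) : (crossroads φ ∩ B).Finite := by
  refine Set.Finite.of_finite_image (f := fun v => ({v} : Set (Space d)))
    ((finite_facets_inter φ 0 hB).subset ?_) Set.singleton_injective.injOn
  rintro _ ⟨v, ⟨hv, hvB⟩, rfl⟩
  exact ⟨hv, v, rfl, hvB⟩

theorem collinear_of_mem_streets {φ : Configuration d} {e : Set (Space d)} (he : e ∈ streets φ) :
    Collinear ℝ e :=
  collinear_iff_finrank_le_one.2 he.2.1.le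

/-- A bounded subset of a line has finite length. -/
theorem hausdorffMeasure_lt_top_of_collinear {s : Set (Space d)} (hs : Collinear ℝ s)
    (hb : Bornology.IsBounded s) : Measure.hausdorffMeasure 1 s < ∞ := by
  rcases s.eq_empty_or_nonempty with rfl | ⟨p₀, hp₀⟩
  · simp
  obtain ⟨v, hv⟩ := (collinear_iff_of_mem hp₀).1 hs
  obtain ⟨R, hR⟩ := hb.subset_closedBall p₀
  have hR0 : 0 ≤ R := dist_nonneg.trans (hR hp₀)
  have hlip : LipschitzWith ‖v‖₊ fun r : ℝ => r • v + p₀ := by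
    refine LipschitzWith.of_dist_le_mul fun a b => ?_
    rw [dist_add_right, dist_eq_norm, ← sub_smul, norm_smul, mul_comm, coe_nnnorm, Real.dist_eq,
      Real.norm_eq_abs]
  have hsub : s ⊆ (fun r : ℝ => r • v + p₀) '' Set.Icc (-(R / ‖v‖)) (R / ‖v‖) := by
    intro p hp
    obtain ⟨r, hr⟩ := hv p hp
    rcases eq_or_ne v 0 with rfl | hv0
    -- Here `R / ‖v‖` is `R / 0 = 0`, and the parameter interval degenerates to `{0}`.
    · exact ⟨0, by simp, by simpa using hr.symm⟩
    · refine ⟨r, ?_, hr.symm⟩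
      have h := hR hp
      rw [hr, Metric.mem_closedBall, vadd_eq_add, dist_eq_norm, add_sub_cancel_right,
        norm_smul, Real.norm_eq_abs, ← le_div_iff₀ (norm_pos_iff.2 hv0)] at h
      exact abs_le.1 h
  calc Measure.hausdorffMeasure 1 s
      ≤ Measure.hausdorffMeasure 1 ((fun r : ℝ => r • v + p₀) '' Set.Icc (-(R / ‖v‖)) (R / ‖v‖)) :=
        measure_mono hsub
    _ ≤ (‖v‖₊ : ℝ≥0∞) ^ (1 : ℝ) * Measure.hausdorffMeasure 1 (Set.Icc (-(R / ‖v‖)) (R / ‖v‖)) :=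
        hlip.hausdorffMeasure_image_le zero_le_one _
    _ < ∞ := by
        rw [hausdorffMeasure_real, Real.volume_Icc, ENNReal.rpow_one]
        exact ENNReal.mul_lt_top ENNReal.coe_lt_top ENNReal.ofReal_lt_top

/-- Finitely many edges meet `B`, each in a bounded piece of a line. Finiteness is what makes the
Poisson void formula applicable to the users. -/
theorem streetMeasure_lt_top (φ : Configuration d) {B : Set (Space d)} (hB : MeasurableSet B)
    (hb : Bornology.IsBounded B) : streetMeasure φ B < ∞ := by
  have hfin := finite_facets_inter φ 1 hb
  rw [streetMeasure, Measure.restrict_apply hB]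
  have hsub : B ∩ ⋃₀ streets φ ⊆ ⋃ e ∈ {F | F ∈ facets φ 1 ∧ (F ∩ B).Nonempty}, e ∩ B := by
    rintro x ⟨hxB, e, he, hxe⟩
    exact Set.mem_biUnion (x := e) ⟨he, x, hxe, hxB⟩ ⟨hxe, hxB⟩
  refine (measure_mono hsub).trans_lt (measure_biUnion_lt_top hfin fun e he => ?_)
  exact hausdorffMeasure_lt_top_of_collinear
    ((collinear_of_mem_streets he.1).subset Set.inter_subset_left)
    (hb.subset Set.inter_subset_right)

/-! ### Translation covariance of the tessellation -/

theorem mem_cell_shift {v x y : Space d} {φ : Configuration d} :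
    y ∈ cell (shift v φ) x ↔ y - v ∈ cell φ (x - v) := by
  simp only [cell, Set.mem_ofPred_eq, mem_shift, dist_sub_right]
  constructor
  · intro h z hz
    simpa [dist_eq_norm, sub_sub, add_comm] using h (z + v) (by simpa using hz)
  · intro h z hz
    simpa using h (z - v) hz

theorem preimage_mem_facets_of_shift {v : Space d} {φ : Configuration d} {k : ℕ}
    {F : Set (Space d)} (hF : F ∈ facets (shift v φ) k) : (fun x => x + v) ⁻¹' F ∈ facets φ k := by
  obtain ⟨⟨y, hy⟩, hk, A, ⟨a, ha⟩, hA, rfl⟩ := hF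
  have hpre : ∀ s : Set (Space d), (fun x => x + v) ⁻¹' s = (-v) +ᵥ s := fun s => by
    ext x
    rw [Set.mem_vadd_set_iff_neg_vadd_mem, neg_neg, vadd_eq_add, add_comm]
    rfl
  refine ⟨⟨y - v, by simpa using hy⟩, by rw [hpre, vectorSpan_vadd]; exact hk,
    (fun x => x + v) ⁻¹' A, ⟨a - v, by simpa using ha⟩, fun x hx => ?_, ?_⟩
  · simpa using mem_shift.1 (hA hx)
  · ext x
    simp only [Set.mem_preimage, Set.mem_iInter, mem_cell_shift, add_sub_cancel_right]
    constructor
    · intro h z hz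
      simpa using h (z + v) hz
    · intro h z hz
      exact h (z - v) (by simpa using hz)

theorem mem_facets_shift {v : Space d} {φ : Configuration d} {k : ℕ} {F : Set (Space d)} :
    F ∈ facets (shift v φ) k ↔ (fun x => x + v) ⁻¹' F ∈ facets φ k := by
  refine ⟨preimage_mem_facets_of_shift, fun h => ?_⟩
  rw [← shift_neg_shift v φ] at h
  have := preimage_mem_facets_of_shift h
  rw [← Set.preimage_comp] at this
  convert this
  ext x
  simp

theorem mem_crossroads_shift {v x : Space d} {φ : Configuration d} :
    x ∈ crossroads (shift v φ) ↔ x - v ∈ crossroads φ := by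
  have h : (fun x => x + v) ⁻¹' {x} = {x - v} := by
    ext y
    simp only [Set.mem_preimage, Set.mem_singleton_iff, eq_sub_iff_add_eq]
  simp only [crossroads, Set.mem_ofPred_eq, mem_facets_shift, h]

theorem exists_street_shift {v z w : Space d} {φ : Configuration d} :
    (∃ e ∈ streets (shift v φ), z ∈ e ∧ w ∈ e) ↔ ∃ e ∈ streets φ, z - v ∈ e ∧ w - v ∈ e := by
  constructor
  · rintro ⟨e, he, hz, hw⟩
    exact ⟨_, mem_facets_shift.1 he, by simpa using hz, by simpa using hw⟩
  · rintro ⟨e, he, hz, hw⟩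
    refine ⟨(fun x => x - v) ⁻¹' e, mem_facets_shift.2 ?_, hz, hw⟩
    have h : (fun x => x + v) ⁻¹' ((fun x => x - v) ⁻¹' e) = e := by
      ext x
      simp only [Set.mem_preimage, add_sub_cancel_right]
    rwa [h]

theorem streetMeasure_shift (v : Space d) (φ : Configuration d) {C : Set (Space d)}
    (hC : MeasurableSet C) :
    streetMeasure (shift v φ) C = streetMeasure φ ((fun x => x + v) ⁻¹' C) := by
  rw [streetMeasure, streetMeasure, Measure.restrict_apply hC,
    Measure.restrict_apply (measurableSet_preimage_add hC v),
    ← (IsometryEquiv.addRight v).hausdorffMeasure_preimage 1 (C ∩ _)]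
  congr 1
  ext x
  have := exists_street_shift (v := v) (z := x + v) (w := x + v) (φ := φ)
  simp only [and_self, add_sub_cancel_right] at this
  simp [Set.mem_sUnion, this]

theorem ncard_crossroads_shift (v : Space d) (φ : Configuration d) (C : Set (Space d)) :
    (crossroads (shift v φ) ∩ C).ncard = (crossroads φ ∩ (fun x => x + v) ⁻¹' C).ncard := by
  rw [← Set.ncard_image_of_injective (crossroads φ ∩ (fun x => x + v) ⁻¹' C)
    (add_left_injective v)]
  congr 1
  ext x
  simp only [Set.mem_inter_iff, mem_crossroads_shift, Set.mem_image, Set.mem_preimage]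
  constructor
  · rintro ⟨h1, h2⟩
    exact ⟨x - v, ⟨h1, by simpa using h2⟩, by simp⟩
  · rintro ⟨y, ⟨h1, h2⟩, rfl⟩
    exact ⟨by simpa using h1, h2⟩

/-! ### Translation invariance of percolation -/

/-- Translating back is an injective graph homomorphism, so it carries an infinite component into an
infinite component. Translation by `-v` then gives the converse. -/
theorem percolates_of_shift {r : ℝ≥0∞} {v : Space d} {φ X Y : Configuration d}
    (h : Percolates r (shift v φ) (shift v X) (shift v Y)) : Percolates r φ X Y := by
  let f : connectivityGraph r (shift v φ) (shift v X) (shift v Y) →g connectivityGraph r φ X Y :=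
    { toFun := fun z => ⟨(z : Space d) - v, z.2⟩
      map_rel' := by
        rintro z w ⟨hne, hst, hd⟩
        refine ⟨fun h => hne ?_, exists_street_shift.1 hst, ?_⟩
        · exact Subtype.ext (sub_left_injective (congrArg Subtype.val h))
        · simpa using hd }
  have hf : Function.Injective f := fun z w h =>
    Subtype.ext (sub_left_injective (congrArg Subtype.val h))
  obtain ⟨C, hC⟩ := h
  refine ⟨C.map f, (hC.image hf.injOn).mono ?_⟩
  rintro _ ⟨z, hz, rfl⟩
  rw [SimpleGraph.ConnectedComponent.mem_supp_iff] at hz ⊢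
  rw [← hz, SimpleGraph.ConnectedComponent.map_mk]

theorem percolates_shift {r : ℝ≥0∞} {v : Space d} {φ X Y : Configuration d} :
    Percolates r (shift v φ) (shift v X) (shift v Y) ↔ Percolates r φ X Y := by
  refine ⟨percolates_of_shift, fun h => ?_⟩
  refine percolates_of_shift (v := -v) ?_
  simpa only [shift_neg_shift] using h

end Tessellation

/-! ### Void probabilities, stationarity and mixing of the joint law. -/

section Laws

open Filter Topology

/-! ### Void probabilities -/

theorem IsPoissonLaw.measure_voidEvent {ρ : Measure (Configuration d)} {μ : Measure (Space d)}
    (h : IsPoissonLaw ρ μ) {C : Set (Space d)} (hC : MeasurableSet C) (hμ : μ C ≠ ∞) :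
    ρ (voidEvent C) = ENNReal.ofReal (Real.exp (-(μ C).toReal)) := by
  rw [voidEvent_eq_count, h.count_eq C hC hμ 0, poissonMeasure_singleton]
  simp only [pow_zero, mul_one, Nat.factorial_zero, Nat.cast_one, div_one]
  rfl

theorem measurableSet_mem_carrier (x : Space d) :
    MeasurableSet {s : Configuration d | x ∈ s.carrier} := by
  have h : {s : Configuration d | x ∈ s.carrier} = (voidEvent {x})ᶜ := by
    ext s
    simp [voidEvent]
  rw [h]
  exact (measurableSet_voidEvent (measurableSet_singleton x)).compl

/-- Almost surely all points lie in `V`, so avoiding `C` means rejecting each of the finitely many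
points of `V ∩ C`, and these are independent events of probability `1 - p`. -/
theorem IsBernoulliLaw.measure_voidEvent {ρ : Measure (Configuration d)} {V : Set (Space d)}
    {p : ℝ} (hp : p ∈ Set.Icc (0 : ℝ) 1) (h : IsBernoulliLaw ρ V p) {C : Set (Space d)}
    (hfin : (V ∩ C).Finite) :
    ρ (voidEvent C) = ENNReal.ofReal ((1 - p) ^ (V ∩ C).ncard) := by
  have := h.isProbabilityMeasure
  have hfin' : {v : V | (v : Space d) ∈ C}.Finite := by
    refine Set.Finite.of_finite_image (f := Subtype.val) (hfin.subset ?_)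
      Subtype.val_injective.injOn
    rintro _ ⟨v, hv, rfl⟩
    exact ⟨v.2, hv⟩
  have hcard : hfin'.toFinset.card = (V ∩ C).ncard := by
    rw [← Set.ncard_eq_toFinset_card _ hfin', ← Set.ncard_image_of_injective _
      Subtype.val_injective]
    congr 1
    ext x
    simp [and_comm]
  have hae : voidEvent C =ᵐ[ρ]
      ⋂ v ∈ hfin'.toFinset, {s : Configuration d | (v : Space d) ∈ s.carrier}ᶜ := by
    filter_upwards [h.subset] with s hs
    apply propext
    change Disjoint s.carrier C ↔ s ∈ ⋂ v ∈ hfin'.toFinset, _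
    simp only [Set.disjoint_left, Set.mem_iInter, Set.Finite.mem_toFinset, Set.mem_ofPred_eq,
      Set.mem_compl_iff, Subtype.forall]
    exact ⟨fun h a _ haC has => h has haC, fun h a has haC => h a (hs has) haC has⟩
  rw [measure_congr hae]
  have hind := (iIndepSet_iff_iIndep _ _).1 h.indep
  rw [hind.meas_biInter fun v _ =>
    (MeasurableSpace.measurableSet_generateFrom (Set.mem_singleton _)).compl]
  have hone : ∀ v : V, ρ {s : Configuration d | (v : Space d) ∈ s.carrier}ᶜ =
      ENNReal.ofReal (1 - p) := fun v => by
    rw [prob_compl_eq_one_sub (measurableSet_mem_carrier _), h.prob_mem v v.2,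
      ENNReal.ofReal_sub _ hp.1, ENNReal.ofReal_one]
  simp_rw [hone]
  rw [Finset.prod_const, hcard, ENNReal.ofReal_pow (sub_nonneg.2 hp.2)]

/-! ### Stationarity and mixing of the generating process -/

theorem eventually_disjoint_preimage_add {v : Space d} (hv : v ≠ 0) {C D : Set (Space d)}
    (hC : Bornology.IsBounded C) (hD : Bornology.IsBounded D) :
    ∀ᶠ n : ℕ in atTop, Disjoint C ((fun x => x + (n : ℝ) • v) ⁻¹' D) := by
  obtain ⟨R, hR⟩ := hC.subset_closedBall 0
  obtain ⟨S, hS⟩ := hD.subset_closedBall 0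
  have ht : Tendsto (fun n : ℕ => (n : ℝ) * ‖v‖) atTop atTop :=
    tendsto_natCast_atTop_atTop.atTop_mul_const (norm_pos_iff.2 hv)
  filter_upwards [ht.eventually_gt_atTop (R + S)] with n hn
  refine Set.disjoint_left.2 fun x hx hxD => ?_
  have h1 : ‖x‖ ≤ R := by simpa using hR hx
  have h2 : ‖x + (n : ℝ) • v‖ ≤ S := by simpa using hS hxD
  have h3 : ‖(n : ℝ) • v‖ = n * ‖v‖ := by rw [norm_smul]; simp
  have h4 := norm_sub_le (x + (n : ℝ) • v) x
  rw [add_sub_cancel_left, h3] at h4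
  linarith

section Poisson

variable {ρ : Measure (Configuration d)} {c : ℝ≥0}

theorem smul_volume_ne_top {C : Set (Space d)} (hC : Bornology.IsBounded C) :
    (c • (volume : Measure (Space d))) C ≠ ∞ := by
  rw [Measure.smul_apply]
  exact ENNReal.mul_ne_top ENNReal.coe_ne_top hC.measure_lt_top.ne

/-- Translation invariance of Lebesgue measure preserves void probabilities, and these determine the
law. -/
theorem IsPoissonLaw.measurePreserving_shift (h : IsPoissonLaw ρ (c • volume)) (v : Space d) :
    MeasurePreserving (shift v) ρ ρ := by
  have := h.isProbabilityMeasure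
  have : IsProbabilityMeasure (ρ.map (shift v)) :=
    Measure.isProbabilityMeasure_map (measurable_shift v).aemeasurable
  refine ⟨measurable_shift v, ext_of_generate_finite _ generateFrom_voidEvents
    isPiSystem_voidEvents ?_ (by simp)⟩
  rintro _ ⟨C, hC, hCb, rfl⟩
  rw [Measure.map_apply (measurable_shift v) (measurableSet_voidEvent hC),
    preimage_shift_voidEvent,
    h.measure_voidEvent (measurableSet_preimage_add hC v)
      (smul_volume_ne_top (isBounded_preimage_add hCb v)),
    h.measure_voidEvent hC (smul_volume_ne_top hCb), Measure.smul_apply, Measure.smul_apply,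
    measure_preimage_add_right]

/-- On void events the sequence is eventually constant: once the windows are disjoint, the
exponential turns additivity of the volume into a product. -/
theorem IsPoissonLaw.mixing (h : IsPoissonLaw ρ (c • volume)) {v : Space d} (hv : v ≠ 0)
    {D E : Set (Configuration d)} (hD : MeasurableSet D) (hE : MeasurableSet E) :
    Tendsto (fun n : ℕ => ρ (D ∩ shift ((n : ℝ) • v) ⁻¹' E)) atTop (𝓝 (ρ D * ρ E)) := by
  have := h.isProbabilityMeasure
  refine tendsto_measure_inter_preimage_of_generateFrom
    (fun n => h.measurePreserving_shift _) generateFrom_voidEvents isPiSystem_voidEvents ?_ hD hE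
  rintro _ ⟨C, hC, hCb, rfl⟩ _ ⟨D, hD, hDb, rfl⟩
  refine tendsto_const_nhds.congr' ?_
  filter_upwards [eventually_disjoint_preimage_add hv hCb hDb] with n hn
  have hD' := measurableSet_preimage_add hD ((n : ℝ) • v)
  have hDb' := isBounded_preimage_add hDb ((n : ℝ) • v)
  rw [← (h.measurePreserving_shift ((n : ℝ) • v)).measure_preimage
    (measurableSet_voidEvent hD).nullMeasurableSet, preimage_shift_voidEvent, voidEvent_inter,
    h.measure_voidEvent hC (smul_volume_ne_top hCb),
    h.measure_voidEvent hD' (smul_volume_ne_top hDb'),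
    h.measure_voidEvent (hC.union hD') (smul_volume_ne_top (hCb.union hDb')),
    measure_union hn hD', ENNReal.toReal_add (smul_volume_ne_top hCb) (smul_volume_ne_top hDb'),
    neg_add, Real.exp_add, ENNReal.ofReal_mul (Real.exp_pos _).le]

end Poisson

/-! ### The joint law -/

/-- The conditional probability, given the generating process, that the generating process, the
users and the relays have no points in `C₀`, `C₁` and `C₂` respectively. -/
def voidProb (lam : ℝ≥0) (p : ℝ) (C₀ C₁ C₂ : Set (Space d)) (φ : Configuration d) : ℝ :=
  (voidEvent C₀).indicator 1 φ * Real.exp (-(lam * (streetMeasure φ C₁).toReal)) *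
    (1 - p) ^ (crossroads φ ∩ C₂).ncard

section VoidProb

variable {lam : ℝ≥0} {p : ℝ} {C₀ C₁ C₂ D₀ D₁ D₂ : Set (Space d)}

theorem voidProb_nonneg (hp : p ∈ Set.Icc (0 : ℝ) 1) (φ : Configuration d) :
    0 ≤ voidProb lam p C₀ C₁ C₂ φ :=
  mul_nonneg (mul_nonneg (Set.indicator_nonneg (fun _ _ => zero_le_one) _) (Real.exp_pos _).le)
    (pow_nonneg (sub_nonneg.2 hp.2) _)

theorem voidProb_le_one (hp : p ∈ Set.Icc (0 : ℝ) 1) (φ : Configuration d) :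
    voidProb lam p C₀ C₁ C₂ φ ≤ 1 := by
  refine mul_le_one₀ (mul_le_one₀ ?_ (Real.exp_pos _).le ?_)
    (pow_nonneg (sub_nonneg.2 hp.2) _) (pow_le_one₀ (sub_nonneg.2 hp.2) (by linarith [hp.1]))
  · exact Set.indicator_le_self' (fun _ _ => zero_le_one) _
  · exact Real.exp_le_one_iff.2 (neg_nonpos.2 (by positivity))

theorem voidProb_shift (h₁ : MeasurableSet C₁) (v : Space d) (φ : Configuration d) :
    voidProb lam p C₀ C₁ C₂ (shift v φ) =
      voidProb lam p ((fun x => x + v) ⁻¹' C₀) ((fun x => x + v) ⁻¹' C₁)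
        ((fun x => x + v) ⁻¹' C₂) φ := by
  rw [voidProb, voidProb, streetMeasure_shift v φ h₁, ncard_crossroads_shift,
    ← preimage_shift_voidEvent]
  rfl

/-- Length and number of crossroads add up over disjoint windows. `C₀` and `D₀` may overlap, since
the indicator of an intersection is always a product. -/
theorem voidProb_union (φ : Configuration d)
    (hC₁ : MeasurableSet C₁) (hC₁b : Bornology.IsBounded C₁)
    (hC₂b : Bornology.IsBounded C₂) (hD₁ : MeasurableSet D₁) (hD₁b : Bornology.IsBounded D₁)
    (hD₂b : Bornology.IsBounded D₂) (h₁ : Disjoint C₁ D₁) (h₂ : Disjoint C₂ D₂) :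
    voidProb lam p (C₀ ∪ D₀) (C₁ ∪ D₁) (C₂ ∪ D₂) φ =
      voidProb lam p C₀ C₁ C₂ φ * voidProb lam p D₀ D₁ D₂ φ := by
  rw [voidProb, voidProb, voidProb, measure_union h₁ hD₁,
    ENNReal.toReal_add (streetMeasure_lt_top φ hC₁ hC₁b).ne (streetMeasure_lt_top φ hD₁ hD₁b).ne,
    mul_add, neg_add, Real.exp_add, Set.inter_union_distrib_left,
    Set.ncard_union_eq (h₂.mono Set.inter_subset_right Set.inter_subset_right)
      (finite_crossroads_inter φ hC₂b) (finite_crossroads_inter φ hD₂b), pow_add,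
    ← voidEvent_inter, Set.inter_indicator_one, Pi.mul_apply]
  ring

end VoidProb

/-- The translation of a triple of configurations. -/
def shiftTriple (v : Space d) (q : Configuration d × Configuration d × Configuration d) :
    Configuration d × Configuration d × Configuration d :=
  (shift v q.1, shift v q.2.1, shift v q.2.2)

theorem measurable_shiftTriple (v : Space d) : Measurable (shiftTriple v) :=
  ((measurable_shift v).comp measurable_fst).prodMk
    (((measurable_shift v).comp (measurable_fst.comp measurable_snd)).prodMk
      ((measurable_shift v).comp (measurable_snd.comp measurable_snd)))

variable (d) in
/-- The products of three void events of bounded Borel sets. -/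
def tripleVoidEvents : Set (Set (Configuration d × Configuration d × Configuration d)) :=
  Set.image2 (· ×ˢ ·) (voidEvents d) (Set.image2 (· ×ˢ ·) (voidEvents d) (voidEvents d))

theorem isPiSystem_tripleVoidEvents : IsPiSystem (tripleVoidEvents d) :=
  isPiSystem_voidEvents.prod (isPiSystem_voidEvents.prod isPiSystem_voidEvents)

theorem generateFrom_tripleVoidEvents :
    (Prod.instMeasurableSpace :
      MeasurableSpace (Configuration d × Configuration d × Configuration d)) =
      MeasurableSpace.generateFrom (tripleVoidEvents d) := by
  refine (generateFrom_eq_prod generateFrom_voidEvents.symm ?_ isCountablySpanning_voidEvents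
    (isCountablySpanning_voidEvents.prod isCountablySpanning_voidEvents)).symm
  exact generateFrom_eq_prod generateFrom_voidEvents.symm generateFrom_voidEvents.symm
    isCountablySpanning_voidEvents isCountablySpanning_voidEvents

section Joint

variable {ρ : Measure (Configuration d)} {κ η : Kernel (Configuration d) (Configuration d)}
  {lam lamS : ℝ≥0} {p : ℝ} {C₀ C₁ C₂ : Set (Space d)}

theorem ae_voidProb_eq (hp : p ∈ Set.Icc (0 : ℝ) 1)
    (hκ : ∀ᵐ φ ∂ρ, IsPoissonLaw (κ φ) (lam • streetMeasure φ))
    (hη : ∀ᵐ φ ∂ρ, IsBernoulliLaw (η φ) (crossroads φ) p)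
    (h₁ : MeasurableSet C₁) (h₁b : Bornology.IsBounded C₁) (h₂b : Bornology.IsBounded C₂) :
    (fun φ => ENNReal.ofReal (voidProb lam p C₀ C₁ C₂ φ)) =ᵐ[ρ]
      (voidEvent C₀).indicator fun φ => κ φ (voidEvent C₁) * η φ (voidEvent C₂) := by
  filter_upwards [hκ, hη] with φ hκφ hηφ
  have hne : (lam • streetMeasure φ) C₁ ≠ ∞ := by
    rw [Measure.smul_apply]
    exact ENNReal.mul_ne_top ENNReal.coe_ne_top (streetMeasure_lt_top φ h₁ h₁b).ne
  by_cases hφ : φ ∈ voidEvent C₀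
  · rw [Set.indicator_of_mem hφ, hκφ.measure_voidEvent h₁ hne,
      hηφ.measure_voidEvent hp (finite_crossroads_inter φ h₂b),
      ← ENNReal.ofReal_mul (Real.exp_pos _).le, voidProb, Set.indicator_of_mem hφ,
      Pi.one_apply, one_mul, Measure.smul_apply, ENNReal.smul_def, smul_eq_mul,
      ENNReal.toReal_mul, ENNReal.coe_toReal]
  · rw [Set.indicator_of_notMem hφ, voidProb, Set.indicator_of_notMem hφ]
    simp

/-- Measurability is read off the kernels, whose void probabilities are measurable in φ; no
measurability of edge lengths or crossroad counts has to be proved from the geometry. -/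
theorem aemeasurable_voidProb (hp : p ∈ Set.Icc (0 : ℝ) 1)
    (hκ : ∀ᵐ φ ∂ρ, IsPoissonLaw (κ φ) (lam • streetMeasure φ))
    (hη : ∀ᵐ φ ∂ρ, IsBernoulliLaw (η φ) (crossroads φ) p) (h₀ : MeasurableSet C₀)
    (h₁ : MeasurableSet C₁) (h₁b : Bornology.IsBounded C₁)
    (h₂ : MeasurableSet C₂) (h₂b : Bornology.IsBounded C₂) :
    AEMeasurable (voidProb lam p C₀ C₁ C₂) ρ := by
  have hm : Measurable ((voidEvent C₀).indicator
      fun φ => κ φ (voidEvent C₁) * η φ (voidEvent C₂)) :=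
    ((κ.measurable_coe (measurableSet_voidEvent h₁)).mul
      (η.measurable_coe (measurableSet_voidEvent h₂))).indicator (measurableSet_voidEvent h₀)
  refine ⟨_, hm.ennreal_toReal, ?_⟩
  filter_upwards [ae_voidProb_eq (C₀ := C₀) hp hκ hη h₁ h₁b h₂b] with φ hφ
  rw [← hφ, ENNReal.toReal_ofReal (voidProb_nonneg hp φ)]

theorem exists_measurable_ae_eq_voidProb (hp : p ∈ Set.Icc (0 : ℝ) 1)
    (hκ : ∀ᵐ φ ∂ρ, IsPoissonLaw (κ φ) (lam • streetMeasure φ))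
    (hη : ∀ᵐ φ ∂ρ, IsBernoulliLaw (η φ) (crossroads φ) p) (h₀ : MeasurableSet C₀)
    (h₁ : MeasurableSet C₁) (h₁b : Bornology.IsBounded C₁)
    (h₂ : MeasurableSet C₂) (h₂b : Bornology.IsBounded C₂) :
    ∃ f : Configuration d → ℝ, Measurable f ∧ (∀ x, 0 ≤ f x) ∧ (∀ x, f x ≤ 1) ∧
      voidProb lam p C₀ C₁ C₂ =ᵐ[ρ] f := by
  have h := aemeasurable_voidProb (C₀ := C₀) hp hκ hη h₀ h₁ h₁b h₂ h₂b
  -- Clamping makes the bounds hold everywhere, as `tendsto_lintegral_mul_comp` demands.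
  refine ⟨fun x => max 0 (min 1 (h.mk _ x)), ?_, by simp, by simp, ?_⟩
  · exact measurable_const.max (measurable_const.min h.measurable_mk)
  · filter_upwards [h.ae_eq_mk] with φ hφ
    rw [← hφ, min_eq_right (voidProb_le_one hp φ), max_eq_right (voidProb_nonneg hp φ)]

variable [IsMarkovKernel κ] [IsMarkovKernel η]

/-- Conditional independence of users and relays enters here: `κ.prod η` gives a rectangle the
product of the two void probabilities. -/
theorem compProd_voidEvent [SFinite ρ] (hp : p ∈ Set.Icc (0 : ℝ) 1)
    (hκ : ∀ᵐ φ ∂ρ, IsPoissonLaw (κ φ) (lam • streetMeasure φ))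
    (hη : ∀ᵐ φ ∂ρ, IsBernoulliLaw (η φ) (crossroads φ) p) (h₀ : MeasurableSet C₀)
    (h₁ : MeasurableSet C₁) (h₁b : Bornology.IsBounded C₁)
    (h₂ : MeasurableSet C₂) (h₂b : Bornology.IsBounded C₂) :
    ρ.compProd (κ.prod η) (voidEvent C₀ ×ˢ voidEvent C₁ ×ˢ voidEvent C₂) =
      ∫⁻ φ, ENNReal.ofReal (voidProb lam p C₀ C₁ C₂ φ) ∂ρ := by
  rw [lintegral_congr_ae (ae_voidProb_eq (C₀ := C₀) hp hκ hη h₁ h₁b h₂b),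
    lintegral_indicator (measurableSet_voidEvent h₀),
    Measure.compProd_apply_prod (measurableSet_voidEvent h₀)
      ((measurableSet_voidEvent h₁).prod (measurableSet_voidEvent h₂))]
  refine lintegral_congr fun φ => ?_
  rw [Kernel.prod_apply, Measure.prod_prod]

theorem preimage_shiftTriple_voidEvent (v : Space d) (C₀ C₁ C₂ : Set (Space d)) :
    shiftTriple v ⁻¹' (voidEvent C₀ ×ˢ voidEvent C₁ ×ˢ voidEvent C₂) =
      voidEvent ((fun x => x + v) ⁻¹' C₀) ×ˢ voidEvent ((fun x => x + v) ⁻¹' C₁) ×ˢ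
        voidEvent ((fun x => x + v) ⁻¹' C₂) := by
  simp only [← preimage_shift_voidEvent]
  rfl

theorem measurePreserving_shiftTriple (hp : p ∈ Set.Icc (0 : ℝ) 1)
    (hρ : IsPoissonLaw ρ (lamS • volume))
    (hκ : ∀ᵐ φ ∂ρ, IsPoissonLaw (κ φ) (lam • streetMeasure φ))
    (hη : ∀ᵐ φ ∂ρ, IsBernoulliLaw (η φ) (crossroads φ) p) (v : Space d) :
    MeasurePreserving (shiftTriple v) (ρ.compProd (κ.prod η)) (ρ.compProd (κ.prod η)) := by
  have := hρ.isProbabilityMeasure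
  have : IsProbabilityMeasure ((ρ.compProd (κ.prod η)).map (shiftTriple v)) :=
    Measure.isProbabilityMeasure_map (measurable_shiftTriple v).aemeasurable
  refine ⟨measurable_shiftTriple v, ext_of_generate_finite _ generateFrom_tripleVoidEvents
    isPiSystem_tripleVoidEvents ?_ (by simp)⟩
  rintro _ ⟨_, ⟨C₀, h₀, h₀b, rfl⟩, _, ⟨_, ⟨C₁, h₁, h₁b, rfl⟩, _, ⟨C₂, h₂, h₂b, rfl⟩, rfl⟩, rfl⟩
  rw [Measure.map_apply (measurable_shiftTriple v) ((measurableSet_voidEvent h₀).prod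
    ((measurableSet_voidEvent h₁).prod (measurableSet_voidEvent h₂))),
    preimage_shiftTriple_voidEvent, compProd_voidEvent hp hκ hη h₀ h₁ h₁b h₂ h₂b,
    compProd_voidEvent hp hκ hη (measurableSet_preimage_add h₀ v)
      (measurableSet_preimage_add h₁ v) (isBounded_preimage_add h₁b v)
      (measurableSet_preimage_add h₂ v) (isBounded_preimage_add h₂b v)]
  simp_rw [← voidProb_shift h₁]
  have hT := hρ.measurePreserving_shift v
  have hm := (aemeasurable_voidProb (C₀ := C₀) hp hκ hη h₀ h₁ h₁b h₂ h₂b).ennreal_ofReal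
  -- By stationarity of `ρ` the right side is an integral against its image under the shift, and a
  -- change of variables finishes.
  conv_rhs => rw [← hT.map_eq]
  rw [lintegral_map' (by rwa [hT.map_eq]) hT.measurable.aemeasurable]

/-- For distant windows the joint void probability is exactly the `ρ`-integral of `f` times a
translate of `g`, with `f`, `g` the two conditional void probabilities; mixing of `ρ` then gives the
limit. -/
theorem mixing_shiftTriple (hp : p ∈ Set.Icc (0 : ℝ) 1)
    (hρ : IsPoissonLaw ρ (lamS • volume))
    (hκ : ∀ᵐ φ ∂ρ, IsPoissonLaw (κ φ) (lam • streetMeasure φ))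
    (hη : ∀ᵐ φ ∂ρ, IsBernoulliLaw (η φ) (crossroads φ) p) {v : Space d} (hv : v ≠ 0)
    {D E : Set (Configuration d × Configuration d × Configuration d)}
    (hD : MeasurableSet D) (hE : MeasurableSet E) :
    Tendsto (fun n : ℕ => ρ.compProd (κ.prod η) (D ∩ shiftTriple ((n : ℝ) • v) ⁻¹' E)) atTop
      (𝓝 (ρ.compProd (κ.prod η) D * ρ.compProd (κ.prod η) E)) := by
  have := hρ.isProbabilityMeasure
  refine tendsto_measure_inter_preimage_of_generateFrom
    (fun n => measurePreserving_shiftTriple hp hρ hκ hη _) generateFrom_tripleVoidEvents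
    isPiSystem_tripleVoidEvents ?_ hD hE
  rintro _ ⟨_, ⟨C₀, h₀, h₀b, rfl⟩, _, ⟨_, ⟨C₁, h₁, h₁b, rfl⟩, _, ⟨C₂, h₂, h₂b, rfl⟩, rfl⟩, rfl⟩
    _ ⟨_, ⟨D₀, k₀, k₀b, rfl⟩, _, ⟨_, ⟨D₁, k₁, k₁b, rfl⟩, _, ⟨D₂, k₂, k₂b, rfl⟩, rfl⟩, rfl⟩
  simp only
  rw [compProd_voidEvent hp hκ hη h₀ h₁ h₁b h₂ h₂b, compProd_voidEvent hp hκ hη k₀ k₁ k₁b k₂ k₂b]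
  obtain ⟨f, hf, hf0, hf1, hfae⟩ :=
    exists_measurable_ae_eq_voidProb (C₀ := C₀) hp hκ hη h₀ h₁ h₁b h₂ h₂b
  obtain ⟨g, hg, hg0, hg1, hgae⟩ :=
    exists_measurable_ae_eq_voidProb (C₀ := D₀) hp hκ hη k₀ k₁ k₁b k₂ k₂b
  have key := tendsto_lintegral_mul_comp (μ := ρ) (T := fun n : ℕ => shift ((n : ℝ) • v))
    (fun n => measurable_shift _) (fun D E hD hE => hρ.mixing hv hD hE) hf hf0 hf1 hg hg0 hg1
  have hfi : ∫⁻ φ, ENNReal.ofReal (voidProb lam p C₀ C₁ C₂ φ) ∂ρ = ∫⁻ φ, ENNReal.ofReal (f φ) ∂ρ :=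
    lintegral_congr_ae (hfae.mono fun φ hφ => by simp only [hφ])
  have hgi : ∫⁻ φ, ENNReal.ofReal (voidProb lam p D₀ D₁ D₂ φ) ∂ρ = ∫⁻ φ, ENNReal.ofReal (g φ) ∂ρ :=
    lintegral_congr_ae (hgae.mono fun φ hφ => by simp only [hφ])
  rw [hfi, hgi]
  refine key.congr' ?_
  filter_upwards [eventually_disjoint_preimage_add hv h₁b k₁b,
    eventually_disjoint_preimage_add hv h₂b k₂b] with n hn₁ hn₂
  have hT := hρ.measurePreserving_shift ((n : ℝ) • v)
  rw [preimage_shiftTriple_voidEvent, Set.prod_inter_prod, Set.prod_inter_prod, voidEvent_inter,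
    voidEvent_inter, voidEvent_inter,
    compProd_voidEvent hp hκ hη (h₀.union (measurableSet_preimage_add k₀ _))
      (h₁.union (measurableSet_preimage_add k₁ _)) (h₁b.union (isBounded_preimage_add k₁b _))
      (h₂.union (measurableSet_preimage_add k₂ _)) (h₂b.union (isBounded_preimage_add k₂b _))]
  refine lintegral_congr_ae ?_
  -- The null set where `g` differs from its `voidProb` pulls back to a null set under the shift.
  filter_upwards [hfae, hT.quasiMeasurePreserving.ae_eq_comp hgae] with φ hφ hφ'
  simp only [Function.comp_apply] at hφ'
  rw [voidProb_union φ h₁ h₁b h₂b (measurableSet_preimage_add k₁ _)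
    (isBounded_preimage_add k₁b _) (isBounded_preimage_add k₂b _) hn₁ hn₂, ← voidProb_shift k₁,
    ENNReal.ofReal_mul (voidProb_nonneg hp φ), hφ, hφ']

end Joint

end Laws

/-! ### Measurability of percolation. -/

section Measurability

variable {β : Type*} [MeasurableSpace β]

/-- Existential quantification of a closed condition over a compact set preserves
measurability. -/
theorem measurableSet_exists_mem_isCompact {E : Type*} [PseudoMetricSpace E] {K : Set E}
    (hK : IsCompact K) {G : E → β → ℝ} (hGm : ∀ y, Measurable (G y))
    (hGc : ∀ b, Continuous fun y => G y b) : MeasurableSet {b | ∃ y ∈ K, G y b ≤ 0} := by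
  have : TopologicalSpace.SeparableSpace K :=
    have := isCompact_iff_compactSpace.1 hK
    inferInstance
  obtain ⟨D, hDc, hD⟩ := TopologicalSpace.exists_countable_dense K
  -- The minimum over `K` is attained, so it is at most 0 iff points of a countable dense set reach
  -- below every `1 / (N + 1)`.
  have h : {b | ∃ y ∈ K, G y b ≤ 0} =
      ⋂ N : ℕ, ⋃ y ∈ D, {b | G (y : K) b < 1 / ((N : ℝ) + 1)} := by
    ext b
    simp only [Set.mem_ofPred_eq, Set.mem_iInter, Set.mem_iUnion, exists_prop]
    constructor
    · rintro ⟨y, hyK, hy⟩ N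
      have hopen : IsOpen {y : K | G y b < 1 / ((N : ℝ) + 1)} :=
        isOpen_lt ((hGc b).comp continuous_subtype_val) continuous_const
      obtain ⟨x, hx, hxD⟩ := hD.inter_open_nonempty _ hopen
        ⟨⟨y, hyK⟩, hy.trans_lt Nat.one_div_pos_of_nat⟩
      exact ⟨x, hxD, hx⟩
    · intro hb
      obtain ⟨y₀, -, -⟩ := hb 0
      obtain ⟨y, hyK, hy⟩ := hK.exists_isMinOn ⟨y₀, y₀.2⟩ (hGc b).continuousOn
      refine ⟨y, hyK, le_of_forall_pos_lt_add fun ε hε => ?_⟩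
      obtain ⟨N, hN⟩ := exists_nat_one_div_lt hε
      obtain ⟨x, -, hx⟩ := hb N
      have := hy x.2
      simp only [Set.mem_ofPred_eq] at this
      linarith
  rw [h]
  exact MeasurableSet.iInter fun N => MeasurableSet.biUnion hDc fun y _ =>
    measurableSet_lt (hGm y) measurable_const

theorem measurable_infDist_carrier {X : β → Configuration d} (hX : Measurable X)
    {y : β → Space d} (hy : Measurable y) :
    Measurable fun b => Metric.infDist (y b) (X b).carrier := by
  refine measurable_of_Iio fun c => ?_
  -- The second set accounts for the empty configuration, where `Metric.infDist` is 0.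
  have h : (fun b => Metric.infDist (y b) (X b).carrier) ⁻¹' Set.Iio c =
      {b | ∃ x ∈ (X b).carrier, dist (y b) x < c} ∪
        ({b | ∃ x ∈ (X b).carrier, True}ᶜ ∩ {_b | 0 < c}) := by
    ext b
    rcases (X b).carrier.eq_empty_or_nonempty with h0 | h0
    · simp [h0]
    · have h1 : ∃ x, x ∈ (X b).carrier := h0
      simp [Metric.infDist_lt_iff h0, h1]
  rw [h]
  refine (measurableSet_exists_point hX ?_).union
    ((measurableSet_exists_point hX (MeasurableSet.const True)).compl.inter (MeasurableSet.const _))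
  exact measurableSet_lt ((hy.comp measurable_fst).dist measurable_snd) measurable_const

theorem mem_cell_iff_le_infDist {φ : Configuration d} {x y : Space d} (hx : x ∈ φ.carrier) :
    y ∈ cell φ x ↔ dist y x ≤ Metric.infDist y φ.carrier :=
  (Metric.le_infDist ⟨x, hx⟩).symm

/-- The Gram determinant of `y - z` and `w - z`. -/
def gram (z w y : Space d) : ℝ :=
  ‖y - z‖ ^ 2 * ‖w - z‖ ^ 2 - inner ℝ (y - z) (w - z) ^ 2

/-- This is the equality case of Cauchy–Schwarz. -/
theorem exists_smul_of_gram_eq_zero {z w y : Space d} (hzw : z ≠ w) (h : gram z w y = 0) :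
    ∃ r : ℝ, y = r • (w - z) +ᵥ z := by
  rcases eq_or_ne y z with rfl | hyz
  · exact ⟨0, by simp⟩
  have hw : w - z ≠ 0 := sub_ne_zero.2 hzw.symm
  have hy : y - z ≠ 0 := sub_ne_zero.2 hyz
  have h1 : ‖inner ℝ (w - z) (y - z)‖ = ‖w - z‖ * ‖y - z‖ := by
    rw [real_inner_comm]
    refine (sq_eq_sq₀ (norm_nonneg _) (by positivity)).1 ?_
    rw [Real.norm_eq_abs, sq_abs, mul_pow]
    rw [gram] at h
    linarith
  obtain ⟨r, -, hr⟩ := (norm_inner_eq_norm_iff hw hy).1 h1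
  exact ⟨r, by rw [← hr, vadd_eq_add, sub_add_cancel]⟩

theorem gram_eq_zero_of_collinear {s : Set (Space d)} (hs : Collinear ℝ s) {z w y : Space d}
    (hz : z ∈ s) (hw : w ∈ s) (hy : y ∈ s) : gram z w y = 0 := by
  obtain ⟨v, hv⟩ := (collinear_iff_of_mem hz).1 hs
  obtain ⟨a, rfl⟩ := hv w hw
  obtain ⟨b, rfl⟩ := hv y hy
  simp only [gram, vadd_eq_add, add_sub_cancel_right, norm_smul, real_inner_smul_left,
    real_inner_smul_right, real_inner_self_eq_norm_sq, mul_pow, Real.norm_eq_abs, sq_abs]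
  ring

/-- An intersection of cells containing `z ≠ w` is an edge iff all its points are on the line
through `z` and `w`. Its nuclei are equidistant from `z`, hence finitely many, so the edge is
encoded by a tuple of points and the dimension by `gram`. -/
theorem exists_street_iff {φ : Configuration d} {z w : Space d} (hzw : z ≠ w) :
    (∃ e ∈ streets φ, z ∈ e ∧ w ∈ e) ↔
      ∃ n : ℕ, ∃ a : Fin (n + 1) → Space d, (∀ k, a k ∈ φ.carrier) ∧
        (∀ k, dist z (a k) ≤ Metric.infDist z φ.carrier) ∧
        (∀ k, dist w (a k) ≤ Metric.infDist w φ.carrier) ∧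
        ∀ y, (∀ k, dist y (a k) ≤ Metric.infDist y φ.carrier) → gram z w y = 0 := by
  constructor
  · rintro ⟨e, he, hz, hw⟩
    have hcol := collinear_of_mem_streets he
    obtain ⟨-, -, A, ⟨x₀, hx₀⟩, hA, rfl⟩ := he
    have hfin : A.Finite := by
      refine (φ.locallyFinite (Metric.closedBall z (dist z x₀))
        Metric.isBounded_closedBall).subset fun x hx => ⟨hA hx, ?_⟩
      rw [Metric.mem_closedBall, dist_comm]
      exact Set.mem_iInter₂.1 hz x hx x₀ (hA hx₀)
    have : Finite A := hfin
    obtain ⟨n, ⟨f⟩⟩ := Finite.exists_equiv_fin A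
    obtain ⟨n, rfl⟩ := Nat.exists_eq_succ_of_ne_zero
      (fun h : n = 0 => by subst h; exact (f ⟨x₀, hx₀⟩).elim0)
    have hmem : ∀ y, y ∈ ⋂ x ∈ A, cell φ x ↔
        ∀ k, dist y (f.symm k : Space d) ≤ Metric.infDist y φ.carrier := fun y => by
      simp only [Set.mem_iInter]
      constructor
      · exact fun h k => (mem_cell_iff_le_infDist (hA (f.symm k).2)).1 (h _ (f.symm k).2)
      · intro h x hx
        have := (mem_cell_iff_le_infDist (hA (f.symm (f ⟨x, hx⟩)).2)).2 (h (f ⟨x, hx⟩))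
        simpa using this
    exact ⟨n, fun k => f.symm k, fun k => hA (f.symm k).2, (hmem z).1 hz, (hmem w).1 hw,
      fun y hy => gram_eq_zero_of_collinear hcol hz hw ((hmem y).2 hy)⟩
  · rintro ⟨n, a, ha, hz, hw, hy⟩
    have hmem : ∀ y, y ∈ ⋂ x ∈ Set.range a, cell φ x ↔
        ∀ k, dist y (a k) ≤ Metric.infDist y φ.carrier := fun y => by
      simp only [Set.mem_iInter, Set.forall_mem_range, mem_cell_iff_le_infDist (ha _)]
    have hz' := (hmem z).2 hz
    have hw' := (hmem w).2 hw
    refine ⟨_, ⟨⟨z, hz'⟩, le_antisymm ?_ ?_, Set.range a, Set.range_nonempty a,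
      Set.range_subset_iff.2 ha, rfl⟩, hz', hw'⟩
    · refine collinear_iff_finrank_le_one.1 ((collinear_iff_of_mem hz').2 ⟨w - z, fun y hy' => ?_⟩)
      exact exists_smul_of_gram_eq_zero hzw (hy y ((hmem y).1 hy'))
    · refine Module.finrank_pos_iff_exists_ne_zero.2
        ⟨⟨w -ᵥ z, vsub_mem_vectorSpan ℝ hw' hz'⟩, fun h => hzw ?_⟩
      exact (vsub_eq_zero_iff_eq.1 (congrArg Subtype.val h)).symm

/-- The complement asks for some `y` off the line. Bounding `‖y‖` by `m` and `|gram|` below by `1 /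
(m + 1)` makes this a countable union of closed conditions on compact balls. -/
theorem measurableSet_exists_equidistant {X : β → Configuration d} (hX : Measurable X)
    {z w : β → Space d} (hz : Measurable z) (hw : Measurable w) {n : ℕ}
    {a : β → Fin n → Space d} (ha : Measurable a) :
    MeasurableSet {b | ∀ y, (∀ k, dist y (a b k) ≤ Metric.infDist y (X b).carrier) →
      gram (z b) (w b) y = 0} := by
  -- A continuous sum of nonnegative penalties, so `G ≤ 0` holds iff every constraint does.
  let G : ℕ → Space d → β → ℝ := fun m y b =>
    ∑ k, max 0 (dist y (a b k) - Metric.infDist y (X b).carrier) +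
      max 0 (1 / ((m : ℝ) + 1) - |gram (z b) (w b) y|)
  have hG : ∀ m y b, G m y b ≤ 0 ↔ (∀ k, dist y (a b k) ≤ Metric.infDist y (X b).carrier) ∧
      1 / ((m : ℝ) + 1) ≤ |gram (z b) (w b) y| := by
    intro m y b
    have h1 : 0 ≤ ∑ k, max 0 (dist y (a b k) - Metric.infDist y (X b).carrier) :=
      Finset.sum_nonneg fun _ _ => le_max_left _ _
    have h2 : 0 ≤ max 0 (1 / ((m : ℝ) + 1) - |gram (z b) (w b) y|) := le_max_left _ _
    have h3 : G m y b ≤ 0 ↔ G m y b = 0 :=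
      ⟨fun h => le_antisymm h (add_nonneg h1 h2), fun h => h.le⟩
    rw [h3, add_eq_zero_iff_of_nonneg h1 h2,
      Finset.sum_eq_zero_iff_of_nonneg fun _ _ => le_max_left _ _]
    simp
  have h : {b | ∀ y, (∀ k, dist y (a b k) ≤ Metric.infDist y (X b).carrier) →
      gram (z b) (w b) y = 0} =
      (⋃ m : ℕ, {b | ∃ y ∈ Metric.closedBall (0 : Space d) m, G m y b ≤ 0})ᶜ := by
    ext b
    simp only [Set.mem_ofPred_eq, Set.mem_compl_iff, Set.mem_iUnion, hG, not_exists, not_and,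
      mem_closedBall_zero_iff, not_le]
    constructor
    · intro h m y _ hy
      rw [h y hy, abs_zero]
      exact Nat.one_div_pos_of_nat
    · intro h y hy
      by_contra hne
      obtain ⟨N, hN⟩ := exists_nat_one_div_lt (abs_pos.2 hne)
      obtain ⟨M, hM⟩ := exists_nat_ge ‖y‖
      have h1 : ‖y‖ ≤ (max N M : ℕ) := hM.trans (by exact_mod_cast le_max_right N M)
      have h2 : 1 / (((max N M : ℕ) : ℝ) + 1) ≤ 1 / ((N : ℝ) + 1) :=
        Nat.one_div_le_one_div (le_max_left N M)
      exact absurd (h _ y h1 hy) (not_lt.2 (h2.trans hN.le))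
  rw [h]
  refine (MeasurableSet.iUnion fun m => measurableSet_exists_mem_isCompact
    (isCompact_closedBall _ _) (fun y => ?_) fun b => ?_).compl
  · have h1 := measurable_infDist_carrier hX (measurable_const (a := y))
    have h2 : ∀ k, Measurable fun b => a b k := fun k => (measurable_pi_apply k).comp ha
    simp only [G, gram]
    fun_prop
  · have h1 := Metric.continuous_infDist_pt (X b).carrier
    simp only [G, gram]
    fun_prop

/-- Two distinct points at distance at most `r` lie on a common street. -/
def Linked (r : ℝ≥0∞) (φ : Configuration d) (z w : Space d) : Prop :=
  z ≠ w ∧ (∃ e ∈ streets φ, z ∈ e ∧ w ∈ e) ∧ edist z w ≤ r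

theorem measurableSet_linked (r : ℝ≥0∞) {X : β → Configuration d} (hX : Measurable X)
    {z w : β → Space d} (hz : Measurable z) (hw : Measurable w) :
    MeasurableSet {b | Linked r (X b) (z b) (w b)} := by
  have h : {b | Linked r (X b) (z b) (w b)} = {b | z b = w b}ᶜ ∩
      ((⋃ n : ℕ, {b | ∃ a : Fin (n + 1) → Space d, (∀ k, a k ∈ (X b).carrier) ∧
        (∀ k, dist (z b) (a k) ≤ Metric.infDist (z b) (X b).carrier) ∧
        (∀ k, dist (w b) (a k) ≤ Metric.infDist (w b) (X b).carrier) ∧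
        ∀ y, (∀ k, dist y (a k) ≤ Metric.infDist y (X b).carrier) → gram (z b) (w b) y = 0}) ∩
      {b | edist (z b) (w b) ≤ r}) := by
    ext b
    simp only [Linked, Set.mem_inter_iff, Set.mem_compl_iff, Set.mem_ofPred_eq, Set.mem_iUnion]
    refine and_congr_right fun hne => ?_
    rw [exists_street_iff hne]
  rw [h]
  refine (measurableSet_eq_fun hz hw).compl.inter
    ((MeasurableSet.iUnion fun n => measurableSet_exists_points hX ?_).inter
      (measurableSet_le (hz.edist hw) measurable_const))
  have hX' : Measurable fun q : β × (Fin (n + 1) → Space d) => X q.1 := hX.comp measurable_fst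
  have hle : ∀ {y : β → Space d}, Measurable y →
      MeasurableSet {q : β × (Fin (n + 1) → Space d) |
        ∀ k, dist (y q.1) (q.2 k) ≤ Metric.infDist (y q.1) (X q.1).carrier} := by
    intro y hy
    have hy' : Measurable fun q : β × (Fin (n + 1) → Space d) => y q.1 := hy.comp measurable_fst
    have h1 := measurable_infDist_carrier hX' hy'
    rw [Set.ofPred_forall]
    exact MeasurableSet.iInter fun k => measurableSet_le (by fun_prop) h1
  exact (hle hz).inter ((hle hw).inter (measurableSet_exists_equidistant hX'
    (hz.comp measurable_fst) (hw.comp measurable_fst) measurable_snd))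

/-- The point `w` can be reached from `z` in `n` steps through points of `X` and `Y`. -/
def ReachableIn (r : ℝ≥0∞) (φ X Y : Configuration d) : ℕ → Space d → Space d → Prop
  | 0, z, w => z = w
  | n + 1, z, w => ∃ u, u ∈ X.carrier ∪ Y.carrier ∧ ReachableIn r φ X Y n z u ∧ Linked r φ u w

theorem measurableSet_exists_mem_union {X Y : β → Configuration d} (hX : Measurable X)
    (hY : Measurable Y) {p : β → Space d → Prop}
    (hp : MeasurableSet {q : β × Space d | p q.1 q.2}) :
    MeasurableSet {b | ∃ x, x ∈ (X b).carrier ∪ (Y b).carrier ∧ p b x} := by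
  have h : {b | ∃ x, x ∈ (X b).carrier ∪ (Y b).carrier ∧ p b x} =
      {b | ∃ x ∈ (X b).carrier, p b x} ∪ {b | ∃ x ∈ (Y b).carrier, p b x} := by
    ext b
    simp only [Set.mem_union, Set.mem_ofPred_eq, or_and_right, exists_or]
  rw [h]
  exact (measurableSet_exists_point hX hp).union (measurableSet_exists_point hY hp)

theorem measurableSet_reachableIn (r : ℝ≥0∞) (n : ℕ) :
    MeasurableSet {q : (Configuration d × Configuration d × Configuration d) ×
      Space d × Space d | ReachableIn r q.1.1 q.1.2.1 q.1.2.2 n q.2.1 q.2.2} := by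
  induction n with
  | zero => exact measurableSet_eq_fun (by fun_prop) (by fun_prop)
  | succ n ih =>
    simp only [ReachableIn]
    refine measurableSet_exists_mem_union (by fun_prop) (by fun_prop) (MeasurableSet.inter ?_ ?_)
    · have hm : Measurable fun q : ((Configuration d × Configuration d × Configuration d) ×
        Space d × Space d) × Space d => (q.1.1, (q.1.2.1, q.2)) := by fun_prop
      exact hm ih
    · exact measurableSet_linked r (by fun_prop) (by fun_prop) (by fun_prop)

/-- The vertex type of the graph depends on the configurations; `ReachableIn` speaks of points of
the fixed ambient space, where joint measurability makes sense. -/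
theorem reachable_iff {r : ℝ≥0∞} {φ X Y : Configuration d} {z w : ↥(X.carrier ∪ Y.carrier)} :
    (connectivityGraph r φ X Y).Reachable z w ↔ ∃ n, ReachableIn r φ X Y n z w := by
  constructor
  · intro h
    rw [SimpleGraph.reachable_iff_reflTransGen] at h
    induction h with
    | refl => exact ⟨0, rfl⟩
    | @tail u v _ huv ih =>
      obtain ⟨n, hn⟩ := ih
      exact ⟨n + 1, u, u.2, hn, fun h => huv.1 (Subtype.ext h), huv.2⟩
  · rintro ⟨n, hn⟩
    induction n generalizing w with
    | zero =>
      have h : z = w := Subtype.ext hn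
      rw [h]
    | succ n ih =>
      obtain ⟨u, hu, hzu, huw⟩ := hn
      refine (ih (w := ⟨u, hu⟩) hzu).trans (SimpleGraph.Adj.reachable ?_)
      exact ⟨fun h => huw.1 (congrArg Subtype.val h), huw.2⟩

/-- By local finiteness, a connected component is infinite iff it is unbounded. -/
theorem percolates_iff {r : ℝ≥0∞} {φ X Y : Configuration d} :
    Percolates r φ X Y ↔ ∃ z, z ∈ X.carrier ∪ Y.carrier ∧ ∀ N : ℕ,
      ∃ w, w ∈ X.carrier ∪ Y.carrier ∧ (N : ℝ) < ‖w‖ ∧ ∃ n, ReachableIn r φ X Y n z w := by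
  have hsupp : ∀ z w : ↥(X.carrier ∪ Y.carrier),
      w ∈ ((connectivityGraph r φ X Y).connectedComponentMk z).supp ↔
        ∃ n, ReachableIn r φ X Y n z w := fun z w => by
    rw [SimpleGraph.ConnectedComponent.mem_supp_iff, SimpleGraph.ConnectedComponent.eq,
      SimpleGraph.reachable_comm, reachable_iff]
  constructor
  · rintro ⟨C, hC⟩
    induction C using SimpleGraph.ConnectedComponent.ind with | _ z => ?_
    refine ⟨z, z.2, fun N => ?_⟩
    by_contra! hcon
    refine hC (Set.Finite.of_finite_image (f := Subtype.val) ?_ Subtype.val_injective.injOn)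
    have hb := Metric.isBounded_closedBall (x := (0 : Space d)) (r := N)
    refine ((X.locallyFinite _ hb).union (Y.locallyFinite _ hb)).subset ?_
    rw [← Set.union_inter_distrib_right]
    rintro _ ⟨w, hw, rfl⟩
    obtain ⟨n, hn⟩ := (hsupp z w).1 hw
    refine ⟨w.2, mem_closedBall_zero_iff.2 ?_⟩
    by_contra! hlt
    exact hcon w w.2 hlt n hn
  · rintro ⟨z, hz, h⟩
    refine ⟨(connectivityGraph r φ X Y).connectedComponentMk ⟨z, hz⟩, fun hfin => ?_⟩
    obtain ⟨R, hR⟩ := (hfin.image fun w : ↥(X.carrier ∪ Y.carrier) => ‖(w : Space d)‖).bddAbove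
    obtain ⟨N, hN⟩ := exists_nat_ge R
    obtain ⟨w, hw, hNw, hn⟩ := h N
    have := hR ⟨⟨w, hw⟩, (hsupp ⟨z, hz⟩ ⟨w, hw⟩).2 hn, rfl⟩
    simp only at this
    linarith

theorem measurableSet_percolates (r : ℝ≥0∞) :
    MeasurableSet {q : Configuration d × Configuration d × Configuration d |
      Percolates r q.1 q.2.1 q.2.2} := by
  simp only [percolates_iff]
  refine measurableSet_exists_mem_union (by fun_prop) (by fun_prop) ?_
  rw [Set.ofPred_forall]
  refine MeasurableSet.iInter fun N => ?_
  refine measurableSet_exists_mem_union (by fun_prop) (by fun_prop)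
    (MeasurableSet.inter (measurableSet_lt measurable_const measurable_snd.norm) ?_)
  change MeasurableSet {q : ((Configuration d × Configuration d × Configuration d) ×
    Space d) × Space d | ∃ n, ReachableIn r q.1.1.1 q.1.1.2.1 q.1.1.2.2 n q.1.2 q.2}
  rw [Set.ofPred_exists]
  refine MeasurableSet.iUnion fun n => ?_
  have hm : Measurable fun q : ((Configuration d × Configuration d × Configuration d) ×
    Space d) × Space d => (q.1.1, (q.1.2, q.2)) := by fun_prop
  exact hm (measurableSet_reachableIn r n)

end Measurability

/-! ### The zero–one law. -/

theorem preimage_shiftTriple_percolates (r : ℝ≥0∞) (v : Space d) :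
    shiftTriple v ⁻¹' {q | Percolates r q.1 q.2.1 q.2.2} =
      {q | Percolates r q.1 q.2.1 q.2.2} := by
  ext q
  exact percolates_shift

theorem IsNetwork.percolates_zero_one (hd : 0 < d) {Ω : Type*} [MeasurableSpace Ω]
    {P : Measure Ω} {lamS lam : ℝ≥0} {p : ℝ} (hp : p ∈ Set.Icc (0 : ℝ) 1)
    {XS X Y : Ω → Configuration d} (h : IsNetwork P lamS lam p XS X Y) (r : ℝ≥0∞) :
    MeasurableSet {ω | Percolates r (XS ω) (X ω) (Y ω)} ∧
      (P {ω | Percolates r (XS ω) (X ω) (Y ω)} = 0 ∨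
        P {ω | Percolates r (XS ω) (X ω) (Y ω)} = 1) := by
  obtain ⟨κ, η, hκM, hηM, hκ, hη, hlaw⟩ := h.conditional
  have := h.poisson.isProbabilityMeasure
  have hm : Measurable fun ω => (XS ω, X ω, Y ω) :=
    h.measurable_XS.prodMk (h.measurable_X.prodMk h.measurable_Y)
  have hA := measurableSet_percolates (d := d) r
  refine ⟨hm hA, ?_⟩
  -- Any nonzero direction serves; one exists because `d` is positive.
  have hv : EuclideanSpace.single (⟨0, hd⟩ : Fin d) (1 : ℝ) ≠ 0 := by simp
  have h01 := measure_eq_zero_or_one_of_mixing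
    (fun D E hD hE => mixing_shiftTriple hp h.poisson hκ hη hv hD hE) hA
    (fun n => preimage_shiftTriple_percolates r _)
  rwa [← hlaw, Measure.map_apply hm hA] at h01

end VoronoiPercolation

end

theorem mainTheorem6 (d : ℕ) (hd : 2 ≤ d)
    (γ p U H : ℝ) (hγ : 0 < γ) (hp : p ∈ Set.Icc (0 : ℝ) 1) (hU : 0 ≤ U) (hH : 0 ≤ H)
    {Ω : Type*} [MeasurableSpace Ω] (P : Measure Ω) [IsProbabilityMeasure P]
    (lamS lam : ℝ≥0) (hlamS : 0 < lamS) (r : ℝ≥0∞)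
    (XS X Y : Ω → VoronoiPercolation.Configuration d)
    (hmodel : VoronoiPercolation.IsNetwork P lamS lam p XS X Y)
    (hγ_eq : VoronoiPercolation.streetIntensity P XS = ENNReal.ofReal γ)
    (hU_eq : lam * VoronoiPercolation.meanStreetLength P XS = ENNReal.ofReal U)
    (hH_eq : VoronoiPercolation.meanStreetLength P XS / r = ENNReal.ofReal H) :
    NullMeasurableSet {ω | VoronoiPercolation.Percolates r (XS ω) (X ω) (Y ω)} P ∧
      (P {ω | VoronoiPercolation.Percolates r (XS ω) (X ω) (Y ω)} = 0 ∨
        P {ω | VoronoiPercolation.Percolates r (XS ω) (X ω) (Y ω)} = 1) := by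
  have h := hmodel.percolates_zero_one (by omega) hp r
  exact ⟨h.1.nullMeasurableSet, h.2⟩
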